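/- For $1\le p<\infty$ and $n\ge 1$ let $B_p^n=\{x\in\mathbb R^n:\sum_i|x_i|^p\le 1\}$, let $X$ be uniformly distributed on $B_p^n$, and for a unit vector $\theta\in\mathbb R^n$ let $A_{p,n,0}(\theta)$ be the value at $0$ of the density of $\langle X,\theta\rangle$ (of any version of it that is continuous at $0$). For $1\le k\le n$ put $$u^{(k)}=\tfrac1{\sqrt k}(\underbrace{1,\dots,1}_{k},0,\dots,0)\in\mathbb R^n .$$ For $k\ge1$ put $S_{p,k}=\mathrm{vol}_{k-1}\big(B_p^k\cap\{x\in\mathbb R^k:x_1+\cdots+x_k=0\}\big)$ (so $S_{p,1}=1$) and $$b_{p,k}=\frac{\Gamma(1+(k-1)/p)}{(2\Gamma(1+1/p))^k}\,S_{p,k}.$$ Let $g_p(x)=e^{-|x|^p}/(2\Gamma(1+1/p))$ for $x\in\mathbb R$, and $\varphi_p(\xi)=\int_{\mathbb R}e^{i\xi x}g_p(x)\,dx$. 1. (Endpoint factorization.) Let $1\le p<\infty$, $n\ge2$ and $1\le k\le n$. Then $\langle X,u^{(k)}\rangle$ has a density that is continuous at $0$, and $$A_{p,n,0}(u^{(k)})=\frac{\Gamma(1+n/p)}{\Gamma(1+(n-1)/p)}\,\frac{\Gamma(1+(k-1)/p)}{(2\Gamma(1+1/p))^k}\,S_{p,k}=\frac{\Gamma(1+n/p)}{\Gamma(1+(n-1)/p)}\,b_{p,k}.$$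 2. (Representation of the constants.) Let $1\le p<\infty$ and $k\ge1$. Then $\varphi_p^k$ is integrable on $\mathbb R$ and $$b_{p,k}=\frac{\sqrt k}{2\pi}\int_{\mathbb R}\varphi_p(\xi)^k\,d\xi .$$ Moreover, if $Z_1,\dots,Z_k$ are independent random variables with density $g_p$, then $(Z_1+\cdots+Z_k)/\sqrt k$ has a density that is continuous at $0$, and its value at $0$ is $b_{p,k}$. 3. (Strict endpoint chain.) Let $1\le p<2$. Then $b_{p,k+1}<b_{p,k}$ for every $k\ge1$, and for every $n\ge2$ $$A_{p,n,0}(u^{(1)})>A_{p,n,0}(u^{(2)})>\cdots>A_{p,n,0}(u^{(n)}).$$ -/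

import Mathlib

open MeasureTheory ProbabilityTheory Filter Topology

noncomputable section

/-- The measure `μ` on `ℝ` has a density with respect to Lebesgue measure that is continuous at `x`
and takes the value `c` there. (Continuity at `x` is what makes the value of a density at the single
point `x` meaningful; see `IsDensityValueAt.unique`.) -/
def IsDensityValueAt (μ : Measure ℝ) (x c : ℝ) : Prop :=
  ∃ f : ℝ → ℝ, Measurable f ∧ (∀ y, 0 ≤ f y) ∧
    μ = volume.withDensity (fun y => ENNReal.ofReal (f y)) ∧ ContinuousAt f x ∧ f x = c

/-- Any two densities of `μ` that are continuous at `x` agree at `x`. -/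
theorem IsDensityValueAt.unique {μ : Measure ℝ} {x c d : ℝ}
    (hc : IsDensityValueAt μ x c) (hd : IsDensityValueAt μ x d) : c = d := by
  obtain ⟨f, hfm, hf0, hfμ, hfc, rfl⟩ := hc
  obtain ⟨g, hgm, hg0, hgμ, hgc, rfl⟩ := hd
  by_contra hne
  have hae : (fun y => ENNReal.ofReal (f y)) =ᵐ[volume] fun y => ENNReal.ofReal (g y) :=
    (withDensity_eq_iff_of_sigmaFinite hfm.ennreal_ofReal.aemeasurable
      hgm.ennreal_ofReal.aemeasurable).1 (hfμ.symm.trans hgμ)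
  have hev : ∀ᶠ y in 𝓝 x, f y ≠ g y := (hfc.ne_iff_eventually_ne hgc).1 hne
  have hpos : 0 < volume {y | f y ≠ g y} :=
    Measure.measure_pos_of_mem_nhds volume hev
  have hzero : volume {y | f y ≠ g y} = 0 := by
    have h2 : ∀ᵐ y, f y = g y := by
      filter_upwards [hae] with y hy
      exact (ENNReal.ofReal_eq_ofReal_iff (hf0 y) (hg0 y)).1 hy
    exact h2
  exact hpos.ne' hzero

open Classical in
/-- The value of the density of `μ` at the point `x`, that is, the common value at `x` of all
densities of `μ` that are continuous at `x` (and `0` if there is none). -/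
def densityAt (μ : Measure ℝ) (x : ℝ) : ℝ :=
  if h : ∃ c, IsDensityValueAt μ x c then h.choose else 0

theorem IsDensityValueAt.densityAt_eq {μ : Measure ℝ} {x c : ℝ} (h : IsDensityValueAt μ x c) :
    densityAt μ x = c := by
  have h' : ∃ c, IsDensityValueAt μ x c := ⟨c, h⟩
  rw [densityAt, dif_pos h']
  exact h'.choose_spec.unique h

/-- The unit ball `B_p^n` of `ℓ_p^n`, as a subset of Euclidean space. -/
def lpUnitBall (p : ℝ) (n : ℕ) : Set (EuclideanSpace ℝ (Fin n)) :=
  {x | ∑ i, |x i| ^ p ≤ 1}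

/-- The uniform probability measure on `B_p^n` (normalized Lebesgue measure). -/
def lpUniform (p : ℝ) (n : ℕ) : Measure (EuclideanSpace ℝ (Fin n)) :=
  (volume (lpUnitBall p n))⁻¹ • volume.restrict (lpUnitBall p n)

/-- The law of `⟨X, θ⟩`, where `X` is uniformly distributed on `B_p^n`. -/
def lpMarginal (p : ℝ) (n : ℕ) (θ : EuclideanSpace ℝ (Fin n)) : Measure ℝ :=
  (lpUniform p n).map (fun x => inner ℝ x θ)

/-- The central section density `A_{p,n,0}(θ)`: the density at `0` of `⟨X, θ⟩`. -/
def centralDensity (p : ℝ) (n : ℕ) (θ : EuclideanSpace ℝ (Fin n)) : ℝ :=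
  densityAt (lpMarginal p n θ) 0

/-- The direction `u^{(k)} = (1, …, 1, 0, …, 0) / √k` in `ℝⁿ`, with `k` ones. -/
def chainDirection (n k : ℕ) : EuclideanSpace ℝ (Fin n) :=
  WithLp.toLp 2 (fun i => if (i : ℕ) < k then 1 / √(k : ℝ) else 0)

/-- `S_{p,k}`, the `(k-1)`-dimensional volume of `B_p^k ∩ {x₁ + ⋯ + x_k = 0}`, for `k ≥ 1`.
Here `μHE[d]` is `d`-dimensional Hausdorff measure normalized to agree with Lebesgue measure. -/
def hyperplaneSection (p : ℝ) (k : ℕ) : ℝ :=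
  (μHE[k - 1] (lpUnitBall p k ∩ {x | ∑ i, x i = 0})).toReal

/-- For `k = 1` the section is the origin, with zero-dimensional volume one. -/
theorem hyperplaneSection_one {p : ℝ} (hp : p ≠ 0) : hyperplaneSection p 1 = 1 := by
  have h : lpUnitBall p 1 ∩ {x | ∑ i, x i = 0} = {0} := by
    ext x
    simp only [lpUnitBall, Set.mem_inter_iff, Set.mem_ofPred_eq, Set.mem_singleton_iff,
      Fin.sum_univ_one]
    constructor
    · rintro ⟨-, h⟩
      ext i
      rw [Fin.fin_one_eq_zero i]
      simpa using h
    · rintro rfl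
      simp [Real.zero_rpow hp]
  rw [hyperplaneSection, h]
  simp [Measure.euclideanHausdorffMeasure_zero]

/-- The endpoint constant `b_{p,k} = Γ(1 + (k-1)/p) / (2 Γ(1 + 1/p))^k * S_{p,k}`. -/
def endpointConstant (p : ℝ) (k : ℕ) : ℝ :=
  Real.Gamma (1 + ((k : ℝ) - 1) / p) / (2 * Real.Gamma (1 + 1 / p)) ^ k * hyperplaneSection p k

/-- The generalized Gaussian density `g_p(x) = exp(-|x|^p) / (2 Γ(1 + 1/p))`. -/
def genGaussianPDF (p : ℝ) (x : ℝ) : ℝ :=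
  Real.exp (-|x| ^ p) / (2 * Real.Gamma (1 + 1 / p))

/-- The probability measure on `ℝ` with density `g_p`. -/
def genGaussian (p : ℝ) : Measure ℝ :=
  volume.withDensity (fun x => ENNReal.ofReal (genGaussianPDF p x))

/-- The characteristic function `φ_p(ξ) = ∫ e^{iξx} g_p(x) dx`. -/
def genGaussianCharFun (p : ℝ) (ξ : ℝ) : ℂ :=
  ∫ x : ℝ, Complex.exp (Complex.I * ξ * x) * (genGaussianPDF p x : ℂ)

end

/-! Factorization. For a subspace `K` of dimension `d`, integrating `exp (-‖y‖_p ^ p)` over level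
sets gives `Γ(1 + d/p)` times the volume of `K ∩ B_p^n`. Taking `K = uᗮ` compares the central
section of the ball with the same section of the product density `∏ g_p`. Hence the density at `0`
of `⟨X, u⟩` is a ratio of Gamma values, independent of `u`, times the density at `0` of `∑ u_i Z_i`
with `Z_i` independent of density `g_p`. For `u = u^{(k)}` the zero coordinates do not affect the
law of this sum, so `n` may be replaced by `k`, and the value is `b_{p,k}`. The carrying lemmas are
`volume_subspace_lpUnitBall`, `isDensityValueAt_lpMarginal` and
`integral_orthogonal_chainDirection`.

Fourier formula. The normalized sum has characteristic function `φ_p(t/√k)^k`. Two integrations by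
parts give `φ_p(ξ) = O(ξ⁻²)`, so inversion at the origin applies: `b_{p,k} = (1/2π) ∫ φ_p(t/√k)^k
dt`.

Strict chain. For `p < 2` the function `exp (-|x|^p)` is a mixture of centred Gaussians, so `φ_p` is
a mixture of functions `exp (-c ξ²)` and is log-convex in `ξ²` by Hölder. Since `φ_p(0) = 1`,
`φ_p(√θ ξ) ≤ φ_p(ξ)^θ`; with `θ = k/(k+1)` the integrand for `k + 1` is at most the one for `k`.
Equality of the integrals would force `φ_p(√θ ξ) = φ_p(ξ)^θ` for all `ξ`, hence a Gaussian law,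
which `g_p` is not. The mixing measure is never constructed: the Lévy measure of `t ^ (p/2)` is
truncated, the resulting compound Poisson exponentials are explicit limits of mixtures, and the
log-convexity inequality survives the limits (`HasLogConvexTransform.of_tendsto`). -/

theorem finrank_orthogonal_unit {E : Type*} [NormedAddCommGroup E] [InnerProductSpace ℝ E]
    [FiniteDimensional ℝ E] {u : E} (hu : ‖u‖ = 1) :
    Module.finrank ℝ (ℝ ∙ u)ᗮ = Module.finrank ℝ E - 1 := by
  have h := (ℝ ∙ u).finrank_add_finrank_orthogonal
  rw [finrank_span_singleton (by rintro rfl; simp at hu)] at h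
  omega

/-! ### Densities of one-dimensional marginals as hyperplane integrals. -/

section Slices

variable {E : Type*} [NormedAddCommGroup E] [InnerProductSpace ℝ E] [FiniteDimensional ℝ E]
  [MeasurableSpace E] [BorelSpace E]

/-- Lebesgue measure on `E` is the product of Lebesgue measures on a line and on its orthogonal
complement. -/
theorem measurePreserving_smul_add_orthogonal {u : E} (hu : ‖u‖ = 1) :
    MeasurePreserving (fun q : ℝ × (ℝ ∙ u)ᗮ => q.1 • u + (q.2 : E)) volume volume := by
  have h1 : MeasurePreserving (Prod.map (LinearIsometryEquiv.toSpanUnitSingleton (𝕜 := ℝ) u hu)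
      (id : (ℝ ∙ u)ᗮ → (ℝ ∙ u)ᗮ)) volume volume :=
    (LinearIsometryEquiv.measurePreserving _).prod (MeasurePreserving.id _)
  have h2 := ((ℝ ∙ u).orthogonalDecomposition.symm.measurePreserving.comp
    (WithLp.volume_preserving_toLp (ℝ ∙ u) (ℝ ∙ u)ᗮ)).comp h1
  convert! h2 using 1

/-- Fubini in the coordinates `t • u + y`. A slice of `F` is integrable only for almost every `t`,
which suffices to identify the two measures. -/
theorem map_inner_withDensity {u : E} (hu : ‖u‖ = 1) {F : E → ℝ} (hF : Measurable F)
    (hF0 : ∀ x, 0 ≤ F x) (hint : Integrable F) :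
    (volume.withDensity fun x => ENNReal.ofReal (F x)).map (fun x => inner ℝ x u) =
      volume.withDensity fun t =>
        ENNReal.ofReal (∫ y : (ℝ ∙ u)ᗮ, F (t • u + (y : E))) := by
  have hmp := measurePreserving_smul_add_orthogonal hu
  have hint' : Integrable (fun q : ℝ × (ℝ ∙ u)ᗮ => F (q.1 • u + (q.2 : E)))
      (volume.prod volume) := hmp.integrable_comp_of_integrable hint
  have hinner : ∀ q : ℝ × (ℝ ∙ u)ᗮ, inner ℝ (q.1 • u + (q.2 : E)) u = q.1 := by
    intro q
    have h := Submodule.mem_orthogonal_singleton_iff_inner_left.1 q.2.2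
    rw [inner_add_left, h, inner_smul_left, real_inner_self_eq_norm_sq, hu]
    simp
  have hm : Measurable (fun x : E => inner ℝ x u) := by fun_prop
  ext s hs
  rw [Measure.map_apply hm hs, withDensity_apply _ (hm hs), withDensity_apply _ hs,
    ← hmp.setLIntegral_comp_preimage (hm hs) (by fun_prop)]
  have hpre : (fun q : ℝ × (ℝ ∙ u)ᗮ => q.1 • u + (q.2 : E)) ⁻¹'
      ((fun x => inner ℝ x u) ⁻¹' s) = s ×ˢ Set.univ := by
    ext q
    simp only [Set.mem_preimage, hinner q, Set.mem_prod, Set.mem_univ, and_true]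
  rw [hpre, Measure.volume_eq_prod, setLIntegral_prod _ (by fun_prop)]
  refine setLIntegral_congr_fun_ae hs ?_
  filter_upwards [hint'.prod_right_ae] with t ht _
  rw [Measure.restrict_univ, ofReal_integral_eq_lintegral_ofReal ht
    (Eventually.of_forall fun y => hF0 _)]

theorem isDensityValueAt_map_inner {u : E} (hu : ‖u‖ = 1) {F : E → ℝ} (hF : Measurable F)
    (hF0 : ∀ x, 0 ≤ F x) (hint : Integrable F)
    (hcont : ContinuousAt (fun t : ℝ => ∫ y : (ℝ ∙ u)ᗮ, F (t • u + (y : E))) 0) :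
    IsDensityValueAt
      ((volume.withDensity fun x => ENNReal.ofReal (F x)).map (fun x => inner ℝ x u)) 0
      (∫ y : (ℝ ∙ u)ᗮ, F y) := by
  refine ⟨_, ?_, fun t => integral_nonneg fun y => hF0 _, map_inner_withDensity hu hF hF0 hint,
    hcont, by simp⟩
  have : StronglyMeasurable (fun q : ℝ × (ℝ ∙ u)ᗮ => F (q.1 • u + (q.2 : E))) :=
    Measurable.stronglyMeasurable (by fun_prop)
  exact this.integral_prod_right.measurable

/-- Translates the Hausdorff measure in `hyperplaneSection` into Lebesgue measure on the hyperplane,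
where the Gamma formula for volumes applies. -/
theorem euclideanHausdorffMeasure_coe_image (K : Submodule ℝ E) (s : Set E) :
    μHE[Module.finrank ℝ K] (s ∩ K) = volume {y : K | (y : E) ∈ s} := by
  rw [← InnerProductSpace.euclideanHausdorffMeasure_eq_volume (V := K),
    ← (isometry_subtype_coe (s := (K : Set E))).euclideanHausdorffMeasure_image]
  congr 1
  ext x
  simp only [Set.mem_inter_iff, Set.mem_image]
  constructor
  · rintro ⟨h1, h2⟩
    exact ⟨⟨x, h2⟩, h1, rfl⟩
  · rintro ⟨y, h1, rfl⟩
    exact ⟨h1, y.2⟩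

theorem integrable_exp_neg_norm : Integrable (fun x : E => Real.exp (-‖x‖)) := by
  obtain hE | hE := subsingleton_or_nontrivial E
  · have : Finite E := inferInstance
    exact Integrable.of_finite
  rw [integrable_fun_norm_addHaar volume (f := fun x => Real.exp (-x))]
  have h := Real.GammaIntegral_convergent (s := Module.finrank ℝ E)
    (Nat.cast_pos.2 Module.finrank_pos)
  refine h.congr_fun (fun x hx => ?_) measurableSet_Ioi
  simp only [smul_eq_mul]
  rw [mul_comm, ← Real.rpow_natCast, Nat.cast_sub Module.finrank_pos, Nat.cast_one]

end Slices

/-! ### Volumes of sections of the ball and continuity of slice integrals at zero. -/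

section LpBall

variable {n : ℕ} {p : ℝ}

theorem lpPow_nonneg (x : EuclideanSpace ℝ (Fin n)) : 0 ≤ ∑ i, |x i| ^ p := by positivity

theorem continuous_lpPow (hp : 0 ≤ p) :
    Continuous fun x : EuclideanSpace ℝ (Fin n) => ∑ i, |x i| ^ p := by
  refine continuous_finsetSum _ fun i _ => ?_
  exact Continuous.rpow_const (by fun_prop) fun x => Or.inr hp

theorem measurableSet_lpUnitBall (hp : 0 ≤ p) : MeasurableSet (lpUnitBall p n) :=
  (isClosed_le (continuous_lpPow hp) continuous_const).measurableSet

theorem norm_le_of_mem_lpUnitBall (hp : 0 < p) {x : EuclideanSpace ℝ (Fin n)}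
    (hx : x ∈ lpUnitBall p n) : ‖x‖ ≤ √n := by
  have h : ∀ i, |x i| ≤ 1 := by
    intro i
    have h1 : |x i| ^ p ≤ 1 :=
      (Finset.single_le_sum (f := fun i => |x i| ^ p) (fun i _ => by positivity)
        (Finset.mem_univ i)).trans hx
    by_contra! h2
    exact absurd h1 (not_le.2 (Real.one_lt_rpow h2 hp))
  rw [EuclideanSpace.norm_eq]
  refine Real.sqrt_le_sqrt ?_
  calc ∑ i, ‖x i‖ ^ 2 ≤ ∑ i : Fin n, (1 : ℝ) :=
        Finset.sum_le_sum fun i _ => by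
          rw [Real.norm_eq_abs]
          exact pow_le_one₀ (abs_nonneg _) (h i)
    _ = n := by simp

theorem rpow_one_div_rpow (hp : 1 ≤ p) (x : EuclideanSpace ℝ (Fin n)) :
    ((∑ i, |x i| ^ p) ^ (1 / p)) ^ p = ∑ i, |x i| ^ p := by
  rw [← Real.rpow_mul (lpPow_nonneg x), div_mul_cancel₀ _ (by linarith : p ≠ 0), Real.rpow_one]

/-- The `p`-norm, restricted to a subspace of Euclidean space, has the properties of a norm. -/
theorem lpNorm_properties (hp : 1 ≤ p) (K : Submodule ℝ (EuclideanSpace ℝ (Fin n))) :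
    let g : K → ℝ := fun x => (∑ i, |(x : EuclideanSpace ℝ (Fin n)) i| ^ p) ^ (1 / p)
    g 0 = 0 ∧ (∀ x, g (-x) = g x) ∧ (∀ x y, g (x + y) ≤ g x + g y) ∧
      (∀ {x}, g x = 0 → x = 0) ∧ ∀ r x, g (r • x) ≤ |r| * g x := by
  intro g
  have h₁ : 0 < p := by linarith
  have hp' : (ENNReal.ofReal p).toReal = p := ENNReal.toReal_ofReal h₁.le
  have : Fact (1 ≤ ENNReal.ofReal p) :=
    fact_iff.mpr (ENNReal.ofReal_one ▸ (ENNReal.ofReal_le_ofReal hp))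
  have hg : ∀ x : K,
      g x = ‖WithLp.toLp (.ofReal p) (WithLp.ofLp (x : EuclideanSpace ℝ (Fin n)))‖ := by
    intro x
    simp [g, PiLp.norm_eq_sum
      (f := WithLp.toLp (.ofReal p) (WithLp.ofLp (x : EuclideanSpace ℝ (Fin n))))
      (hp'.symm ▸ h₁), hp']
  simp only [hg]
  refine ⟨by simp, fun x => ?_, fun x y => ?_, fun {x} hx => ?_, fun r x => ?_⟩
  · simp
  · simpa using norm_add_le (WithLp.toLp (.ofReal p) (WithLp.ofLp (x : EuclideanSpace ℝ (Fin n))))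
      (WithLp.toLp (.ofReal p) (WithLp.ofLp (y : EuclideanSpace ℝ (Fin n))))
  · rw [norm_eq_zero] at hx
    simpa using hx
  · have := norm_smul_le r (WithLp.toLp (.ofReal p) (WithLp.ofLp (x : EuclideanSpace ℝ (Fin n))))
    simpa using this

theorem mem_lpUnitBall_iff_rpow (hp : 1 ≤ p) (x : EuclideanSpace ℝ (Fin n)) :
    x ∈ lpUnitBall p n ↔ (∑ i, |x i| ^ p) ^ (1 / p) ≤ 1 := by
  have h := Real.rpow_le_rpow_iff (lpPow_nonneg (p := p) x) zero_le_one
    (by positivity : 0 < 1 / p)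
  rw [Real.one_rpow] at h
  exact h.symm

/-- The `p`-norm on `K` is a norm, so its unit sphere is null. On the trivial subspace both sets are
all of `K`. -/
theorem volume_subspace_sum_rpow_le_eq_lt (hp : 1 ≤ p)
    (K : Submodule ℝ (EuclideanSpace ℝ (Fin n))) :
    volume {y : K | (y : EuclideanSpace ℝ (Fin n)) ∈ lpUnitBall p n} =
      volume {y : K | ∑ i, |(y : EuclideanSpace ℝ (Fin n)) i| ^ p < 1} := by
  have h0 : 0 < p := by linarith
  obtain hK | hK := subsingleton_or_nontrivial K
  · congr 1
    ext y
    rw [Subsingleton.elim y 0]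
    simp [lpUnitBall, Real.zero_rpow h0.ne']
  · obtain ⟨h1, h2, h3, h4, h5⟩ := lpNorm_properties hp K
    have h := measure_le_eq_lt volume h1 h2 h3 h4 h5 1
    convert! h using 2
    · ext y
      exact mem_lpUnitBall_iff_rpow hp _
    · ext y
      exact (Real.rpow_lt_one_iff' (lpPow_nonneg _) (by positivity)).symm

theorem volume_subspace_lpUnitBall (hp : 1 ≤ p)
    (K : Submodule ℝ (EuclideanSpace ℝ (Fin n))) :
    volume {y : K | (y : EuclideanSpace ℝ (Fin n)) ∈ lpUnitBall p n} =
      ENNReal.ofReal ((∫ y : K, Real.exp (-∑ i, |(y : EuclideanSpace ℝ (Fin n)) i| ^ p)) /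
        Real.Gamma (1 + Module.finrank ℝ K / p)) := by
  have h0 : 0 < p := by linarith
  rw [volume_subspace_sum_rpow_le_eq_lt hp]
  obtain ⟨h1, h2, h3, h4, h5⟩ := lpNorm_properties hp K
  have h := measure_lt_one_eq_integral_div_gamma volume h1 h2 h3 h4 h5 h0
  simp only [rpow_one_div_rpow hp] at h
  rw [add_comm (1 : ℝ), ← h]
  congr 1
  ext y
  exact (Real.rpow_lt_one_iff' (lpPow_nonneg _) (by positivity)).symm

theorem volume_lpUnitBall (hp : 1 ≤ p) (hn : n ≠ 0) :
    volume (lpUnitBall p n) =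
      ENNReal.ofReal ((2 * Real.Gamma (1 + 1 / p)) ^ n / Real.Gamma (1 + n / p)) := by
  have : Nonempty (Fin n) := Fin.pos_iff_nonempty.1 (Nat.pos_of_ne_zero hn)
  have h := volume_sum_rpow_le (Fin n) hp 1
  rw [← (PiLp.volume_preserving_ofLp (Fin n)).measure_preimage] at h
  · rw [add_comm (1 : ℝ), add_comm (1 : ℝ)]
    simp only [ENNReal.ofReal_one, one_pow, one_mul, Fintype.card_fin] at h
    rw [← h]
    congr 1
    ext y
    exact mem_lpUnitBall_iff_rpow hp _
  · refine (measurableSet_le ?_ measurable_const).nullMeasurableSet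
    fun_prop

theorem volume_subspace_sum_rpow_eq_one (hp : 1 ≤ p)
    (K : Submodule ℝ (EuclideanSpace ℝ (Fin n))) :
    volume {y : K | ∑ i, |(y : EuclideanSpace ℝ (Fin n)) i| ^ p = 1} = 0 := by
  have h := volume_subspace_sum_rpow_le_eq_lt hp K
  have hc : Continuous fun y : K => ∑ i, |(y : EuclideanSpace ℝ (Fin n)) i| ^ p :=
    (continuous_lpPow (by linarith)).comp continuous_subtype_val
  have hfin := volume_subspace_lpUnitBall hp K ▸ ENNReal.ofReal_ne_top
  have h2 := measure_sdiff (μ := volume)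
    (s₁ := {y : K | (y : EuclideanSpace ℝ (Fin n)) ∈ lpUnitBall p n})
    (s₂ := {y : K | ∑ i, |(y : EuclideanSpace ℝ (Fin n)) i| ^ p < 1})
    (fun y hy => (Set.mem_ofPred.mp hy).le)
    (isOpen_lt hc continuous_const).measurableSet.nullMeasurableSet
    (h ▸ hfin)
  rw [h, tsub_self] at h2
  rw [← h2]
  congr 1
  ext y
  simp only [lpUnitBall, Set.mem_sdiff, Set.mem_ofPred_eq, not_lt]
  exact le_antisymm_iff

theorem norm_le_norm_smul_add {u : EuclideanSpace ℝ (Fin n)} (t : ℝ) (y : (ℝ ∙ u)ᗮ) :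
    ‖(y : EuclideanSpace ℝ (Fin n))‖ ≤ ‖t • u + (y : EuclideanSpace ℝ (Fin n))‖ := by
  have h := Submodule.mem_orthogonal_singleton_iff_inner_right.1 y.2
  have h2 := norm_add_sq_eq_norm_sq_add_norm_sq_real (x := t • u)
    (y := (y : EuclideanSpace ℝ (Fin n))) (by rw [inner_smul_left, h, mul_zero])
  nlinarith [norm_nonneg (t • u), norm_nonneg (t • u + (y : EuclideanSpace ℝ (Fin n))),
    norm_nonneg (y : EuclideanSpace ℝ (Fin n))]

/-- Dominated convergence: the slices stay in one Euclidean ball, and the indicator is locally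
constant in `t` near `0` unless `y` lies on the unit `p`-sphere, a null subset of the hyperplane. -/
theorem continuousAt_slice_lpUnitBall (hp : 1 ≤ p) (u : EuclideanSpace ℝ (Fin n)) (c : ℝ) :
    ContinuousAt (fun t : ℝ => ∫ y : (ℝ ∙ u)ᗮ,
      (lpUnitBall p n).indicator (fun _ => c) (t • u + (y : EuclideanSpace ℝ (Fin n)))) 0 := by
  have h0 : 0 < p := by linarith
  refine continuousAt_of_dominated
    (bound := (Metric.closedBall (0 : (ℝ ∙ u)ᗮ) √n).indicator fun _ => ‖c‖) ?_ ?_ ?_ ?_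
  · refine Eventually.of_forall fun t => Measurable.aestronglyMeasurable ?_
    exact (measurable_const.indicator (measurableSet_lpUnitBall h0.le)).comp (by fun_prop)
  · refine Eventually.of_forall fun t => Eventually.of_forall fun y => ?_
    by_cases hy : t • u + (y : EuclideanSpace ℝ (Fin n)) ∈ lpUnitBall p n
    · have hy' : y ∈ Metric.closedBall (0 : (ℝ ∙ u)ᗮ) √n := by
        rw [mem_closedBall_zero_iff]
        exact (norm_le_norm_smul_add t y).trans (norm_le_of_mem_lpUnitBall h0 hy)
      rw [Set.indicator_of_mem hy, Set.indicator_of_mem hy']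
    · rw [Set.indicator_of_notMem hy, norm_zero]
      exact Set.indicator_nonneg (fun _ _ => norm_nonneg _) _
  · exact (integrable_indicator_iff measurableSet_closedBall).2
      (integrableOn_const measure_closedBall_lt_top.ne)
  · have hae : ∀ᵐ y : (ℝ ∙ u)ᗮ, ∑ i, |(y : EuclideanSpace ℝ (Fin n)) i| ^ p ≠ 1 := by
      rw [ae_iff]
      simpa using volume_subspace_sum_rpow_eq_one hp (ℝ ∙ u)ᗮ
    filter_upwards [hae] with y hy
    have hc : Continuous fun t : ℝ =>
        ∑ i, |(t • u + (y : EuclideanSpace ℝ (Fin n))) i| ^ p :=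
      (continuous_lpPow h0.le).comp (by fun_prop)
    have hy0 : ∑ i, |((0 : ℝ) • u + (y : EuclideanSpace ℝ (Fin n))) i| ^ p ≠ 1 := by simpa using hy
    rcases lt_or_gt_of_ne hy0 with hlt | hgt
    · refine (continuousAt_const (y := c)).congr ?_
      filter_upwards [hc.continuousAt.eventually_lt_const hlt] with t ht
      rw [Set.indicator_of_mem]
      exact le_of_lt ht
    · refine (continuousAt_const (y := (0 : ℝ))).congr ?_
      filter_upwards [hc.continuousAt.eventually_const_lt hgt] with t ht
      rw [Set.indicator_of_notMem]
      exact not_le.2 ht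

/-- A bound uniform in small shifts, used for domination. In the exponent `2`, one unit comes from
`x - 1 ≤ x ^ p` and one from `|s| ≤ 1`. -/
theorem exp_neg_abs_add_rpow_le (hp : 1 ≤ p) {a s : ℝ} (hs : |s| ≤ 1) :
    Real.exp (-|s + a| ^ p) ≤ Real.exp 2 * Real.exp (-|a|) := by
  rw [← Real.exp_add, Real.exp_le_exp]
  have h1 : |s + a| - 1 ≤ |s + a| ^ p := by
    rcases le_total 1 |s + a| with h | h
    · have := Real.rpow_le_rpow_of_exponent_le h hp
      rw [Real.rpow_one] at this
      linarith
    · have : 0 ≤ |s + a| ^ p := by positivity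
      linarith
  have h2 : |a| ≤ |s + a| + |s| := by
    have := abs_sub (s + a) s
    rwa [add_sub_cancel_left] at this
  linarith

theorem norm_le_sum_abs (x : EuclideanSpace ℝ (Fin n)) : ‖x‖ ≤ ∑ i, |x i| := by
  rw [EuclideanSpace.norm_eq]
  refine Real.sqrt_le_iff.2 ⟨by positivity, ?_⟩
  exact Finset.sum_sq_le_sq_sum_of_nonneg fun i _ => abs_nonneg _

theorem exp_neg_lpPow_add_le (hp : 1 ≤ p) {s y : EuclideanSpace ℝ (Fin n)} (hs : ‖s‖ ≤ 1) :
    Real.exp (-∑ i, |(s + y) i| ^ p) ≤ Real.exp 2 ^ n * Real.exp (-‖y‖) := by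
  calc Real.exp (-∑ i, |(s + y) i| ^ p) = ∏ i, Real.exp (-|(s + y) i| ^ p) := by
        rw [← Finset.sum_neg_distrib, Real.exp_sum]
    _ ≤ ∏ i, (Real.exp 2 * Real.exp (-|y i|)) :=
        Finset.prod_le_prod (fun i _ => by positivity) fun i _ =>
          exp_neg_abs_add_rpow_le hp ((PiLp.norm_apply_le s i).trans hs)
    _ = Real.exp 2 ^ n * Real.exp (-∑ i, |y i|) := by
        rw [Finset.prod_mul_distrib, ← Finset.sum_neg_distrib, Real.exp_sum Finset.univ]
        simp
    _ ≤ _ := by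
        gcongr
        exact norm_le_sum_abs y

theorem continuousAt_slice_exp_lpPow (hp : 1 ≤ p) {u : EuclideanSpace ℝ (Fin n)} (hu : ‖u‖ = 1)
    (c : ℝ) :
    ContinuousAt (fun t : ℝ => ∫ y : (ℝ ∙ u)ᗮ,
      c * Real.exp (-∑ i, |(t • u + (y : EuclideanSpace ℝ (Fin n))) i| ^ p)) 0 := by
  have h0 : 0 < p := by linarith
  have hc := continuous_lpPow (n := n) h0.le
  refine continuousAt_of_dominated
    (bound := fun y => ‖c‖ * (Real.exp 2 ^ n * Real.exp (-‖y‖))) ?_ ?_ ?_ ?_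
  · refine Eventually.of_forall fun t => Continuous.aestronglyMeasurable ?_
    have := hc.comp (by fun_prop : Continuous fun y : (ℝ ∙ u)ᗮ =>
      t • u + (y : EuclideanSpace ℝ (Fin n)))
    exact continuous_const.mul (Real.continuous_exp.comp this.neg)
  · filter_upwards [Metric.closedBall_mem_nhds (0 : ℝ) one_pos] with t ht
    refine Eventually.of_forall fun y => ?_
    rw [norm_mul, Real.norm_of_nonneg (Real.exp_pos _).le]
    refine mul_le_mul_of_nonneg_left (exp_neg_lpPow_add_le hp ?_) (norm_nonneg _)
    rwa [norm_smul, hu, mul_one, ← mem_closedBall_zero_iff]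
  · exact (integrable_exp_neg_norm.const_mul _).const_mul _
  · refine Eventually.of_forall fun y => Continuous.continuousAt ?_
    have := hc.comp (by fun_prop : Continuous fun t : ℝ =>
      t • u + (y : EuclideanSpace ℝ (Fin n)))
    exact continuous_const.mul (Real.continuous_exp.comp this.neg)

end LpBall

/-! ### Products of generalized Gaussians and the endpoint factorization. -/

section GenGaussian

variable {n : ℕ} {p : ℝ}

theorem two_mul_Gamma_pos (hp : 0 < p) : 0 < 2 * Real.Gamma (1 + 1 / p) :=
  mul_pos two_pos (Real.Gamma_pos_of_pos (by positivity))

theorem genGaussianPDF_pos (hp : 0 < p) (x : ℝ) : 0 < genGaussianPDF p x :=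
  div_pos (Real.exp_pos _) (two_mul_Gamma_pos hp)

theorem continuous_exp_neg_abs_rpow (hp : 0 ≤ p) : Continuous fun x : ℝ => Real.exp (-|x| ^ p) :=
  Real.continuous_exp.comp (Continuous.rpow_const continuous_abs fun _ => Or.inr hp).neg

theorem continuous_genGaussianPDF (hp : 0 ≤ p) : Continuous (genGaussianPDF p) :=
  (continuous_exp_neg_abs_rpow hp).div_const _

theorem integral_exp_neg_abs_rpow (hp : 0 < p) :
    ∫ x : ℝ, Real.exp (-|x| ^ p) = 2 * Real.Gamma (1 + 1 / p) := by
  rw [integral_comp_abs (f := fun x => Real.exp (-x ^ p)), integral_exp_neg_rpow hp, add_comm]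

theorem integrable_exp_neg_abs_rpow (hp : 0 < p) : Integrable fun x : ℝ => Real.exp (-|x| ^ p) :=
  Integrable.of_integral_ne_zero (by
    rw [integral_exp_neg_abs_rpow hp]; exact (two_mul_Gamma_pos hp).ne')

theorem integrable_genGaussianPDF (hp : 0 < p) : Integrable (genGaussianPDF p) :=
  (integrable_exp_neg_abs_rpow hp).div_const _

theorem integral_genGaussianPDF (hp : 0 < p) : ∫ x, genGaussianPDF p x = 1 := by
  simp only [genGaussianPDF]
  rw [integral_div, integral_exp_neg_abs_rpow hp, div_self (two_mul_Gamma_pos hp).ne']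

theorem isProbabilityMeasure_genGaussian (hp : 0 < p) : IsProbabilityMeasure (genGaussian p) := by
  constructor
  rw [genGaussian, withDensity_apply _ MeasurableSet.univ, Measure.restrict_univ,
    ← ofReal_integral_eq_lintegral_ofReal (integrable_genGaussianPDF hp)
      (Eventually.of_forall fun x => (genGaussianPDF_pos hp x).le), integral_genGaussianPDF hp,
    ENNReal.ofReal_one]

theorem charFun_withDensity_ofReal {f : ℝ → ℝ} (hf : Measurable f) (hf0 : ∀ x, 0 ≤ f x) (t : ℝ) :
    charFun (volume.withDensity fun x => ENNReal.ofReal (f x)) t =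
      ∫ x : ℝ, Complex.exp (Complex.I * t * x) * (f x : ℂ) := by
  rw [charFun_apply_real, integral_withDensity_eq_integral_toReal_smul hf.ennreal_ofReal
    (Eventually.of_forall fun _ => ENNReal.ofReal_lt_top)]
  congr with x
  rw [ENNReal.toReal_ofReal (hf0 x), Complex.real_smul, mul_comm]
  congr 2
  ring

theorem charFun_genGaussian (hp : 0 < p) (t : ℝ) :
    charFun (genGaussian p) t = genGaussianCharFun p t :=
  charFun_withDensity_ofReal (continuous_genGaussianPDF hp.le).measurable
    (fun x => (genGaussianPDF_pos hp x).le) t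

theorem genGaussianCharFun_zero (hp : 0 < p) : genGaussianCharFun p 0 = 1 := by
  have := isProbabilityMeasure_genGaussian hp
  rw [← charFun_genGaussian hp, charFun_zero]
  simp

/-- The density of `n` independent variables with density `g_p`. -/
noncomputable def genGaussianVecPDF (p : ℝ) (n : ℕ) (x : EuclideanSpace ℝ (Fin n)) : ℝ :=
  ((2 * Real.Gamma (1 + 1 / p)) ^ n)⁻¹ * Real.exp (-∑ i, |x i| ^ p)

theorem genGaussianVecPDF_eq_prod (x : EuclideanSpace ℝ (Fin n)) :
    genGaussianVecPDF p n x = ∏ i, genGaussianPDF p (x i) := by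
  simp only [genGaussianVecPDF, genGaussianPDF]
  rw [Finset.prod_div_distrib, ← Real.exp_sum, Finset.sum_neg_distrib, Finset.prod_const,
    Finset.card_univ, Fintype.card_fin, div_eq_mul_inv (Real.exp _), mul_comm]

theorem genGaussianVecPDF_nonneg (hp : 0 < p) (x : EuclideanSpace ℝ (Fin n)) :
    0 ≤ genGaussianVecPDF p n x := by
  have := two_mul_Gamma_pos hp
  rw [genGaussianVecPDF]
  positivity

theorem continuous_genGaussianVecPDF (hp : 0 ≤ p) : Continuous (genGaussianVecPDF p n) :=
  continuous_const.mul (Real.continuous_exp.comp (continuous_lpPow hp).neg)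

theorem integrable_genGaussianVecPDF (hp : 0 < p) : Integrable (genGaussianVecPDF p n) := by
  rw [← (PiLp.volume_preserving_toLp (Fin n)).integrable_comp_emb
    (MeasurableEquiv.toLp 2 (Fin n → ℝ)).measurableEmbedding]
  have h := Integrable.fintype_prod (ι := Fin n) (f := fun _ => genGaussianPDF p)
    (μ := fun _ => volume) fun _ => integrable_genGaussianPDF hp
  refine h.congr (Eventually.of_forall fun x => ?_)
  simp [genGaussianVecPDF_eq_prod]

/-- The law of `∑ i, u i * Z i`, for independent `Z i` with density `g_p`. -/
noncomputable def genGaussianMarginal (p : ℝ) (n : ℕ) (u : EuclideanSpace ℝ (Fin n)) : Measure ℝ :=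
  (volume.withDensity fun x => ENNReal.ofReal (genGaussianVecPDF p n x)).map
    fun x => inner ℝ x u

theorem isFiniteMeasure_genGaussianMarginal (hp : 0 < p) (u : EuclideanSpace ℝ (Fin n)) :
    IsFiniteMeasure (genGaussianMarginal p n u) := by
  have := isFiniteMeasure_withDensity_ofReal (integrable_genGaussianVecPDF (n := n) hp).2
  rw [genGaussianMarginal]
  infer_instance

theorem charFun_genGaussianMarginal (hp : 0 < p) (u : EuclideanSpace ℝ (Fin n)) (t : ℝ) :
    charFun (genGaussianMarginal p n u) t = ∏ i, genGaussianCharFun p (t * u i) := by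
  rw [charFun_apply_real, genGaussianMarginal, integral_map (by fun_prop) (by fun_prop),
    integral_withDensity_eq_integral_toReal_smul
      (continuous_genGaussianVecPDF hp.le).measurable.ennreal_ofReal
      (Eventually.of_forall fun _ => ENNReal.ofReal_lt_top),
    ← (PiLp.volume_preserving_toLp (Fin n)).integral_comp
      (MeasurableEquiv.toLp 2 (Fin n → ℝ)).measurableEmbedding]
  simp only [genGaussianCharFun]
  rw [← integral_fintype_prod_volume_eq_prod]
  congr with x
  rw [ENNReal.toReal_ofReal (genGaussianVecPDF_nonneg hp _), genGaussianVecPDF_eq_prod,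
    Finset.prod_mul_distrib, ← Complex.exp_sum, Complex.real_smul, Complex.ofReal_prod, mul_comm]
  congr 2
  simp only [PiLp.inner_apply, RCLike.inner_apply, conj_trivial, Complex.ofReal_sum,
    Complex.ofReal_mul, Finset.mul_sum, Finset.sum_mul]
  refine Finset.sum_congr rfl fun i _ => ?_
  ring

theorem isDensityValueAt_genGaussianMarginal (hp : 1 ≤ p) {u : EuclideanSpace ℝ (Fin n)}
    (hu : ‖u‖ = 1) :
    IsDensityValueAt (genGaussianMarginal p n u) 0
      (∫ y : (ℝ ∙ u)ᗮ, genGaussianVecPDF p n y) := by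
  have h0 : 0 < p := by linarith
  exact isDensityValueAt_map_inner hu (continuous_genGaussianVecPDF h0.le).measurable
    (genGaussianVecPDF_nonneg h0) (integrable_genGaussianVecPDF h0)
    (continuousAt_slice_exp_lpPow hp hu _)

/-- Central sections of the `ℓ_p` ball through the density at zero of weighted sums of independent
variables with density `g_p`. -/
theorem isDensityValueAt_lpMarginal (hp : 1 ≤ p) (hn : n ≠ 0) {u : EuclideanSpace ℝ (Fin n)}
    (hu : ‖u‖ = 1) :
    IsDensityValueAt (lpMarginal p n u) 0
      (Real.Gamma (1 + n / p) / Real.Gamma (1 + ((n : ℝ) - 1) / p) *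
        ∫ y : (ℝ ∙ u)ᗮ, genGaussianVecPDF p n y) := by
  have h0 : 0 < p := by linarith
  have hc := two_mul_Gamma_pos h0
  have hn1 : (0 : ℝ) ≤ (n : ℝ) - 1 := by
    rw [sub_nonneg]
    exact_mod_cast Nat.one_le_iff_ne_zero.2 hn
  have hG1 : 0 < Real.Gamma (1 + n / p) := Real.Gamma_pos_of_pos (by positivity)
  have hG2 : 0 < Real.Gamma (1 + ((n : ℝ) - 1) / p) := Real.Gamma_pos_of_pos (by positivity)
  have hB := measurableSet_lpUnitBall (n := n) h0.le
  have hV := volume_lpUnitBall hp hn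
  set V := (2 * Real.Gamma (1 + 1 / p)) ^ n / Real.Gamma (1 + n / p) with hVdef
  have hVpos : 0 < V := by positivity
  have hunif : lpUniform p n = volume.withDensity fun x =>
      ENNReal.ofReal ((lpUnitBall p n).indicator (fun _ => V⁻¹) x) := by
    rw [lpUniform, hV, ← ENNReal.ofReal_inv_of_pos hVpos]
    ext s hs
    rw [Measure.smul_apply, Measure.restrict_apply hs, withDensity_apply _ hs]
    have : (fun x => ENNReal.ofReal ((lpUnitBall p n).indicator (fun _ => V⁻¹) x)) =
        (lpUnitBall p n).indicator fun _ => ENNReal.ofReal V⁻¹ := by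
      ext x
      by_cases hx : x ∈ lpUnitBall p n <;> simp [hx]
    rw [this, lintegral_indicator hB, setLIntegral_const, Measure.restrict_apply hB, smul_eq_mul,
      Set.inter_comm]
  have hint : Integrable ((lpUnitBall p n).indicator fun _ => V⁻¹) :=
    (integrable_indicator_iff hB).2 (integrableOn_const (by rw [hV]; exact ENNReal.ofReal_ne_top))
  have h := isDensityValueAt_map_inner hu (measurable_const.indicator hB)
    (Set.indicator_nonneg fun _ _ => (inv_pos.2 hVpos).le) hint
    (continuousAt_slice_lpUnitBall hp u V⁻¹)
  rw [← hunif] at h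
  convert! h using 1
  have hval : (∫ y : (ℝ ∙ u)ᗮ, (lpUnitBall p n).indicator (fun _ => V⁻¹)
      (y : EuclideanSpace ℝ (Fin n))) =
      (volume {y : (ℝ ∙ u)ᗮ | (y : EuclideanSpace ℝ (Fin n)) ∈ lpUnitBall p n}).toReal * V⁻¹ := by
    have hm : MeasurableSet {y : (ℝ ∙ u)ᗮ | (y : EuclideanSpace ℝ (Fin n)) ∈ lpUnitBall p n} :=
      measurable_subtype_coe hB
    rw [← smul_eq_mul, ← measureReal_def, ← setIntegral_const, ← integral_indicator hm]
    rfl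
  -- The hyperplane has dimension `n - 1`, which gives the Gamma factor in the denominator; the
  -- numerator comes from `V⁻¹`, whose power of `2 Γ(1 + 1/p)` normalizes the product density.
  rw [hval, volume_subspace_lpUnitBall hp, finrank_orthogonal_unit hu, finrank_euclideanSpace,
    Fintype.card_fin, Nat.cast_sub (Nat.one_le_iff_ne_zero.2 hn), Nat.cast_one,
    ENNReal.toReal_ofReal (by positivity)]
  simp only [genGaussianVecPDF, integral_const_mul, hVdef]
  field_simp

theorem norm_chainDirection {k : ℕ} (hk : 1 ≤ k) (hkn : k ≤ n) : ‖chainDirection n k‖ = 1 := by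
  have hk0 : (k : ℝ) ≠ 0 := by positivity
  rw [EuclideanSpace.norm_eq, Real.sqrt_eq_one]
  have h : ∀ i : Fin n, ‖chainDirection n k i‖ ^ 2 = if (i : ℕ) < k then (1 : ℝ) / k else 0 := by
    intro i
    simp only [chainDirection]
    split_ifs <;> simp
  simp only [h]
  rw [Finset.sum_ite, Finset.sum_const_zero, add_zero, Finset.sum_const, Fin.card_filter_val_lt,
    min_eq_right hkn, nsmul_eq_mul, mul_one_div_cancel hk0]

theorem charFun_genGaussianMarginal_chainDirection (hp : 0 < p) {k : ℕ} (hkn : k ≤ n) (t : ℝ) :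
    charFun (genGaussianMarginal p n (chainDirection n k)) t =
      genGaussianCharFun p (t / √(k : ℝ)) ^ k := by
  rw [charFun_genGaussianMarginal hp]
  have h : ∀ i : Fin n, genGaussianCharFun p (t * chainDirection n k i) =
      if (i : ℕ) < k then genGaussianCharFun p (t / √(k : ℝ)) else 1 := by
    intro i
    simp only [chainDirection]
    split_ifs
    · rw [mul_one_div]
    · rw [mul_zero, genGaussianCharFun_zero hp]
  simp only [h]
  rw [Finset.prod_ite, Finset.prod_const_one, mul_one, Finset.prod_const, Fin.card_filter_val_lt,
    min_eq_right hkn]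

theorem orthogonal_chainDirection_self {k : ℕ} (hk : 1 ≤ k) :
    (((ℝ ∙ chainDirection k k)ᗮ : Submodule ℝ (EuclideanSpace ℝ (Fin k))) :
      Set (EuclideanSpace ℝ (Fin k))) = {x | ∑ i, x i = 0} := by
  ext x
  rw [SetLike.mem_coe, Submodule.mem_orthogonal_singleton_iff_inner_left]
  have : inner ℝ x (chainDirection k k) = (∑ i, x i) / √(k : ℝ) := by
    simp [chainDirection, PiLp.inner_apply, Finset.mul_sum, div_eq_inv_mul]
  rw [this, div_eq_zero_iff, or_iff_left (by positivity)]
  rfl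

theorem endpointConstant_eq_integral (hp : 1 ≤ p) {k : ℕ} (hk : 1 ≤ k) :
    endpointConstant p k = ∫ y : (ℝ ∙ chainDirection k k)ᗮ, genGaussianVecPDF p k y := by
  have h0 : 0 < p := by linarith
  have hc := two_mul_Gamma_pos h0
  have hk1 : (0 : ℝ) ≤ (k : ℝ) - 1 := by
    rw [sub_nonneg]
    exact_mod_cast hk
  have hG2 : 0 < Real.Gamma (1 + ((k : ℝ) - 1) / p) := Real.Gamma_pos_of_pos (by positivity)
  have hr : Module.finrank ℝ (ℝ ∙ chainDirection k k)ᗮ = k - 1 := by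
    rw [finrank_orthogonal_unit (norm_chainDirection hk le_rfl), finrank_euclideanSpace,
      Fintype.card_fin]
  have h := euclideanHausdorffMeasure_coe_image (ℝ ∙ chainDirection k k)ᗮ (lpUnitBall p k)
  rw [hr, orthogonal_chainDirection_self hk, volume_subspace_lpUnitBall hp, hr,
    Nat.cast_sub hk, Nat.cast_one] at h
  rw [endpointConstant, hyperplaneSection, h, ENNReal.toReal_ofReal (by positivity)]
  simp only [genGaussianVecPDF, integral_const_mul]
  field_simp

theorem isDensityValueAt_genGaussianMarginal_self (hp : 1 ≤ p) {k : ℕ} (hk : 1 ≤ k) :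
    IsDensityValueAt (genGaussianMarginal p k (chainDirection k k)) 0 (endpointConstant p k) := by
  rw [endpointConstant_eq_integral hp hk]
  exact isDensityValueAt_genGaussianMarginal hp (norm_chainDirection hk le_rfl)

/-- Zero coordinates contribute the factor `φ_p(0) = 1`, so the marginals in dimensions `n` and `k`
have the same characteristic function, hence the same law and the same density value at `0`. -/
theorem integral_orthogonal_chainDirection (hp : 1 ≤ p) {k : ℕ} (hk : 1 ≤ k) (hkn : k ≤ n) :
    ∫ y : (ℝ ∙ chainDirection n k)ᗮ, genGaussianVecPDF p n y = endpointConstant p k := by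
  have h0 : 0 < p := by linarith
  have := isFiniteMeasure_genGaussianMarginal h0 (chainDirection n k)
  have := isFiniteMeasure_genGaussianMarginal h0 (chainDirection k k)
  have h : genGaussianMarginal p n (chainDirection n k) =
      genGaussianMarginal p k (chainDirection k k) := by
    refine Measure.ext_of_charFun (funext fun t => ?_)
    rw [charFun_genGaussianMarginal_chainDirection h0 hkn,
      charFun_genGaussianMarginal_chainDirection h0 le_rfl]
  exact (isDensityValueAt_genGaussianMarginal hp (norm_chainDirection hk hkn)).unique
    (h ▸ isDensityValueAt_genGaussianMarginal_self hp hk)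

theorem isDensityValueAt_lpMarginal_chainDirection (hp : 1 ≤ p) {k : ℕ} (hk : 1 ≤ k)
    (hkn : k ≤ n) :
    IsDensityValueAt (lpMarginal p n (chainDirection n k)) 0
      (Real.Gamma (1 + n / p) / Real.Gamma (1 + ((n : ℝ) - 1) / p) * endpointConstant p k) := by
  rw [← integral_orthogonal_chainDirection hp hk hkn]
  exact isDensityValueAt_lpMarginal hp (by omega) (norm_chainDirection hk hkn)

theorem isDensityValueAt_normalized_sum (hp : 1 ≤ p) {k : ℕ} (hk : 1 ≤ k) {Ω : Type*}
    [MeasurableSpace Ω] {P : Measure Ω} [IsProbabilityMeasure P] {Z : Fin k → Ω → ℝ}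
    (hZ : iIndepFun Z P) (hlaw : ∀ i, HasLaw (Z i) (genGaussian p) P) :
    IsDensityValueAt (P.map fun ω => (∑ i, Z i ω) / √(k : ℝ)) 0 (endpointConstant p k) := by
  have h0 : 0 < p := by linarith
  have := isFiniteMeasure_genGaussianMarginal h0 (chainDirection k k)
  have hm : ∀ i, AEMeasurable (Z i) P := fun i => (hlaw i).aemeasurable
  have h : P.map (fun ω => (∑ i, Z i ω) / √(k : ℝ)) =
      genGaussianMarginal p k (chainDirection k k) := by
    refine Measure.ext_of_charFun (funext fun t => ?_)
    rw [charFun_genGaussianMarginal_chainDirection h0 le_rfl]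
    simp only [div_eq_inv_mul]
    rw [charFun_map_mul_comp (by fun_prop), hZ.charFun_map_fun_sum_eq_prod hm]
    simp [(hlaw _).map_eq, charFun_genGaussian h0]
  rw [h]
  exact isDensityValueAt_genGaussianMarginal_self hp hk

end GenGaussian

/-! ### Decay of the characteristic function and Fourier inversion. -/

section Fourier

variable {p : ℝ}

/-- The cosine transform of a function on the line. -/
noncomputable def cosTransform (f : ℝ → ℝ) (ξ : ℝ) : ℝ := ∫ x, Real.cos (ξ * x) * f x

theorem integrable_cos_mul {f : ℝ → ℝ} (hf : Integrable f) (ξ : ℝ) :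
    Integrable fun x => Real.cos (ξ * x) * f x :=
  hf.bdd_mul (c := 1) (by fun_prop) (Eventually.of_forall fun x => by
    simpa using Real.abs_cos_le_one _)

theorem integrable_sin_mul {f : ℝ → ℝ} (hf : Integrable f) (ξ : ℝ) :
    Integrable fun x => Real.sin (ξ * x) * f x :=
  hf.bdd_mul (c := 1) (by fun_prop) (Eventually.of_forall fun x => by
    simpa using Real.abs_sin_le_one _)

theorem integral_cexp_mul_eq_cosTransform {f : ℝ → ℝ} (hf : Integrable f)
    (heven : ∀ x, f (-x) = f x) (ξ : ℝ) :
    ∫ x : ℝ, Complex.exp (Complex.I * ξ * x) * (f x : ℂ) = cosTransform f ξ := by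
  have hsin : ∫ x, Real.sin (ξ * x) * f x = 0 := by
    have h := integral_neg_eq_self (fun x => Real.sin (ξ * x) * f x) volume
    simp only [heven, mul_neg, Real.sin_neg, neg_mul, integral_neg] at h
    linarith
  have h : ∀ x : ℝ, Complex.exp (Complex.I * ξ * x) * (f x : ℂ) =
      ((Real.cos (ξ * x) * f x : ℝ) : ℂ) + Complex.I * ((Real.sin (ξ * x) * f x : ℝ) : ℂ) := by
    intro x
    rw [show Complex.I * ξ * x = ((ξ * x : ℝ) : ℂ) * Complex.I by push_cast; ring,
      Complex.exp_mul_I]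
    push_cast
    ring
  simp only [h]
  rw [integral_add (integrable_cos_mul hf ξ).ofReal ((integrable_sin_mul hf ξ).ofReal.const_mul _),
    integral_const_mul, integral_complex_ofReal, integral_complex_ofReal, hsin]
  simp [cosTransform]

theorem genGaussianCharFun_eq_cosTransform (hp : 0 < p) (ξ : ℝ) :
    genGaussianCharFun p ξ = cosTransform (genGaussianPDF p) ξ :=
  integral_cexp_mul_eq_cosTransform (integrable_genGaussianPDF hp)
    (fun x => by simp [genGaussianPDF]) ξ

theorem continuous_cosTransform {f : ℝ → ℝ} (hf : Integrable f) : Continuous (cosTransform f) := by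
  refine continuous_of_dominated (bound := fun x => ‖f x‖) ?_ ?_ hf.norm ?_
  · exact fun ξ => (integrable_cos_mul hf ξ).aestronglyMeasurable
  · refine fun ξ => Eventually.of_forall fun x => ?_
    rw [norm_mul]
    exact mul_le_of_le_one_left (norm_nonneg _) (Real.abs_cos_le_one _)
  · exact Eventually.of_forall fun x => by fun_prop

theorem integrableOn_rpow_mul_exp_neg (hp : 1 ≤ p) {s : ℝ} (hs : -1 < s) :
    IntegrableOn (fun x : ℝ => x ^ s * Real.exp (-x ^ p)) (Set.Ioi 0) :=
  integrableOn_rpow_mul_exp_neg_rpow hs (by linarith)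

theorem tendsto_rpow_mul_exp_neg_rpow (hp : 1 ≤ p) (s : ℝ) :
    Tendsto (fun x : ℝ => x ^ s * Real.exp (-x ^ p)) atTop (𝓝 0) := by
  have h0 : 0 < p := by linarith
  refine ((tendsto_rpow_mul_exp_neg_mul_atTop_nhds_zero (s / p) 1 one_pos).comp
    (tendsto_rpow_atTop h0)).congr' ?_
  filter_upwards [eventually_ge_atTop 0] with x hx
  rw [Function.comp_apply, ← Real.rpow_mul hx, mul_div_cancel₀ _ h0.ne', neg_one_mul]

/-- Two integrations by parts on the half-line; `h1` and `h2` are the first and second derivatives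
of `exp (-x ^ p)` there. -/
theorem exists_abs_integral_cos_mul_exp_neg_rpow_le (hp : 1 ≤ p) :
    ∃ C, ∀ ξ : ℝ, ξ ≠ 0 →
      |∫ x in Set.Ioi (0 : ℝ), Real.cos (ξ * x) * Real.exp (-x ^ p)| ≤ C / ξ ^ 2 := by
  have h0 : 0 < p := by linarith
  set h1 : ℝ → ℝ := fun x => -(p * (x ^ (p - 1) * Real.exp (-x ^ p)))
  set h2 : ℝ → ℝ := fun x =>
    p ^ 2 * (x ^ (2 * p - 2) * Real.exp (-x ^ p)) -
      p * ((p - 1) * (x ^ (p - 2) * Real.exp (-x ^ p)))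
  have hd0 : ∀ x ∈ Set.Ioi (0 : ℝ), HasDerivAt (fun x : ℝ => Real.exp (-x ^ p)) (h1 x) x := by
    intro x hx
    convert! ((Real.hasDerivAt_rpow_const (p := p) (Or.inl (ne_of_gt hx))).neg.exp) using 1
    simp only [h1, Pi.neg_apply]
    ring
  have hd1 : ∀ x ∈ Set.Ioi (0 : ℝ), HasDerivAt h1 (h2 x) x := by
    intro x hx
    convert! (((Real.hasDerivAt_rpow_const (p := p - 1) (Or.inl (ne_of_gt hx))).mul
      (hd0 x hx)).const_mul p).neg using 1
    simp only [h1, h2]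
    rw [show 2 * p - 2 = (p - 1) + (p - 1) by ring, Real.rpow_add hx,
      show p - 1 - 1 = p - 2 by ring]
    ring
  have hi0 : IntegrableOn (fun x : ℝ => Real.exp (-x ^ p)) (Set.Ioi 0) := by
    simpa using integrableOn_rpow_mul_exp_neg hp (s := 0) (by norm_num)
  have hi2 : IntegrableOn h2 (Set.Ioi 0) := by
    refine ((integrableOn_rpow_mul_exp_neg hp (by linarith)).const_mul _).sub
      (Integrable.const_mul ?_ _)
    -- The power `x ^ (p - 2)` is not integrable at `0` when `p = 1`, but then its coefficient `p -
    -- 1` vanishes.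
    rcases hp.eq_or_lt with rfl | hp1
    · simp
    · exact (integrableOn_rpow_mul_exp_neg hp (by linarith)).const_mul _
  refine ⟨2 * ∫ x in Set.Ioi (0 : ℝ), |h2 x|, fun ξ hξ => ?_⟩
  -- Both integrations by parts in one primitive. Using `cos - 1` instead of `cos` makes `G 0 = 0`
  -- even for `p = 1`, where `h1 0 ≠ 0`; the bound `|cos - 1| ≤ 2` yields the factor `2` in the
  -- constant.
  set G : ℝ → ℝ := fun x =>
    Real.exp (-x ^ p) * (Real.sin (ξ * x) / ξ) + h1 x * ((Real.cos (ξ * x) - 1) / ξ ^ 2)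
  have hic : IntegrableOn (fun x => Real.cos (ξ * x) * Real.exp (-x ^ p)) (Set.Ioi 0) :=
    hi0.bdd_mul (c := 1) (by fun_prop) (Eventually.of_forall fun x => by
      simpa using Real.abs_cos_le_one _)
  have hbd : ∀ x, |(Real.cos (ξ * x) - 1) / ξ ^ 2| ≤ 2 / ξ ^ 2 := by
    intro x
    rw [abs_div, abs_of_nonneg (sq_nonneg ξ)]
    gcongr
    rw [abs_le]
    constructor <;> linarith [Real.neg_one_le_cos (ξ * x), Real.cos_le_one (ξ * x)]
  have hib : IntegrableOn (fun x => (Real.cos (ξ * x) - 1) / ξ ^ 2 * h2 x) (Set.Ioi 0) :=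
    hi2.bdd_mul (c := 2 / ξ ^ 2) (by fun_prop) (Eventually.of_forall hbd)
  have hG : ∀ x ∈ Set.Ioi (0 : ℝ), HasDerivAt G
      (Real.cos (ξ * x) * Real.exp (-x ^ p) + (Real.cos (ξ * x) - 1) / ξ ^ 2 * h2 x) x := by
    intro x hx
    have hl : HasDerivAt (fun x : ℝ => ξ * x) ξ x := by
      simpa using (hasDerivAt_id x).const_mul ξ
    convert! ((hd0 x hx).mul (hl.sin.div_const ξ)).add
      ((hd1 x hx).mul ((hl.cos.sub_const 1).div_const (ξ ^ 2))) using 1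
    field_simp
    ring
  have hh1c : Continuous h1 := by
    have : Continuous fun x : ℝ => x ^ (p - 1) :=
      Real.continuous_rpow_const (by linarith)
    have : Continuous fun x : ℝ => x ^ p := Real.continuous_rpow_const (by linarith)
    fun_prop
  have hGc : Continuous G := by
    have : Continuous fun x : ℝ => x ^ p := Real.continuous_rpow_const (by linarith)
    fun_prop
  have hlim : Tendsto G atTop (𝓝 0) := by
    have ht0 : Tendsto (fun x : ℝ => Real.exp (-x ^ p)) atTop (𝓝 0) := by
      simpa using tendsto_rpow_mul_exp_neg_rpow hp 0
    have ht1 : Tendsto h1 atTop (𝓝 0) := by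
      simpa using ((tendsto_rpow_mul_exp_neg_rpow hp (p - 1)).const_mul p).neg
    have hs : ∀ x, |Real.sin (ξ * x) / ξ| ≤ 1 / |ξ| := by
      intro x
      rw [abs_div]
      gcongr
      exact Real.abs_sin_le_one _
    have e1 := ht0.zero_mul_isBoundedUnder_le
      (isBoundedUnder_of ⟨_, hs⟩ : IsBoundedUnder (· ≤ ·) atTop
        (norm ∘ fun x => Real.sin (ξ * x) / ξ))
    have e2 := ht1.zero_mul_isBoundedUnder_le
      (isBoundedUnder_of ⟨_, hbd⟩ : IsBoundedUnder (· ≤ ·) atTop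
        (norm ∘ fun x => (Real.cos (ξ * x) - 1) / ξ ^ 2))
    simpa using e1.add e2
  have key := integral_Ioi_of_hasDerivAt_of_tendsto hGc.continuousWithinAt hG (hic.add hib) hlim
  rw [integral_add hic hib] at key
  have hG0 : G 0 = 0 := by simp [G]
  rw [hG0, sub_zero] at key
  rw [eq_neg_of_add_eq_zero_left key, abs_neg, mul_div_right_comm, ← integral_const_mul]
  refine (abs_integral_le_integral_abs).trans (integral_mono hib.abs (hi2.abs.const_mul _) ?_)
  intro x
  simp only [abs_mul]
  exact mul_le_mul_of_nonneg_right (hbd x) (abs_nonneg _)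

theorem cosTransform_genGaussianPDF (hp : 0 < p) (ξ : ℝ) :
    cosTransform (genGaussianPDF p) ξ =
      (∫ x in Set.Ioi (0 : ℝ), Real.cos (ξ * x) * Real.exp (-x ^ p)) / Real.Gamma (1 + 1 / p) := by
  have hG : Real.Gamma (1 + 1 / p) ≠ 0 := (Real.Gamma_pos_of_pos (by positivity)).ne'
  have h := integral_comp_abs (f := fun x => Real.cos (ξ * x) * Real.exp (-x ^ p))
  have hcos : ∀ x, Real.cos (ξ * |x|) = Real.cos (ξ * x) := by
    intro x
    rcases abs_choice x with hx | hx <;> rw [hx]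
    rw [mul_neg, Real.cos_neg]
  simp only [hcos] at h
  simp only [cosTransform, genGaussianPDF, mul_div_assoc']
  rw [integral_div, h]
  field_simp

theorem norm_genGaussianCharFun_le_one (hp : 0 < p) (ξ : ℝ) : ‖genGaussianCharFun p ξ‖ ≤ 1 := by
  have := isProbabilityMeasure_genGaussian hp
  rw [← charFun_genGaussian hp]
  exact norm_charFun_le_one _

theorem continuous_genGaussianCharFun (hp : 0 < p) : Continuous (genGaussianCharFun p) := by
  rw [funext (genGaussianCharFun_eq_cosTransform hp)]
  exact Complex.continuous_ofReal.comp (continuous_cosTransform (integrable_genGaussianPDF hp))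

theorem integrable_genGaussianCharFun (hp : 1 ≤ p) : Integrable (genGaussianCharFun p) := by
  have h0 : 0 < p := by linarith
  obtain ⟨C, hC⟩ := exists_abs_integral_cos_mul_exp_neg_rpow_le hp
  have hG : 0 < Real.Gamma (1 + 1 / p) := Real.Gamma_pos_of_pos (by positivity)
  have hC0 : 0 ≤ C := by
    have := (abs_nonneg _).trans (hC 1 one_ne_zero)
    simpa using this
  refine (integrable_inv_one_add_sq.const_mul (1 + C / Real.Gamma (1 + 1 / p))).mono'
    (continuous_genGaussianCharFun h0).aestronglyMeasurable (Eventually.of_forall fun ξ => ?_)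
  rw [← div_eq_mul_inv, le_div_iff₀ (by positivity), mul_one_add]
  refine add_le_add (norm_genGaussianCharFun_le_one h0 ξ) ?_
  rcases eq_or_ne ξ 0 with rfl | hξ
  · simp only [ne_eq, OfNat.ofNat_ne_zero, not_false_eq_true, zero_pow, mul_zero]
    positivity
  · rw [← le_div_iff₀ (by positivity), genGaussianCharFun_eq_cosTransform h0,
      cosTransform_genGaussianPDF h0, Complex.norm_real, norm_div, Real.norm_eq_abs,
      Real.norm_of_nonneg hG.le, div_right_comm]
    gcongr
    exact hC ξ hξ

theorem integrable_genGaussianCharFun_pow (hp : 1 ≤ p) {k : ℕ} (hk : 1 ≤ k) :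
    Integrable fun ξ => genGaussianCharFun p ξ ^ k := by
  have h0 : 0 < p := by linarith
  refine (integrable_genGaussianCharFun hp).mono
    ((continuous_genGaussianCharFun h0).pow k).aestronglyMeasurable
    (Eventually.of_forall fun ξ => ?_)
  rw [norm_pow]
  exact pow_le_of_le_one (norm_nonneg _) (norm_genGaussianCharFun_le_one h0 ξ) (by omega)

/-- Fourier inversion at the origin. -/
theorem IsDensityValueAt.eq_integral_charFun {μ : Measure ℝ} [IsFiniteMeasure μ] {c : ℝ}
    (h : IsDensityValueAt μ 0 c) (hμ : Integrable (charFun μ)) :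
    (c : ℂ) = ((1 / (2 * Real.pi) : ℝ) : ℂ) * ∫ t, charFun μ t := by
  obtain ⟨f, hfm, hf0, hfμ, hfc, rfl⟩ := h
  have hfint : Integrable f := by
    refine ⟨hfm.aestronglyMeasurable, ?_⟩
    have h1 : μ Set.univ = ∫⁻ y, ENNReal.ofReal (f y) := by
      rw [hfμ, withDensity_apply _ MeasurableSet.univ, Measure.restrict_univ]
    rw [hasFiniteIntegral_iff_ofReal (Eventually.of_forall hf0), ← h1]
    exact measure_lt_top μ _
  -- The Fourier transform uses the kernel `exp (-2πi x ξ)`, hence the rescaling by `-2π` and the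
  -- final factor `1 / (2π)`.
  have hF : (FourierTransform.fourier fun x : ℝ => (f x : ℂ)) =
      fun ξ : ℝ => charFun μ (-(2 * Real.pi) * ξ) := by
    ext ξ
    rw [Real.fourier_real_eq_integral_exp_smul, hfμ, charFun_withDensity_ofReal hfm hf0]
    congr with x
    rw [smul_eq_mul]
    congr 2
    push_cast
    ring
  have hpi : -(2 * Real.pi) ≠ 0 := by simp [Real.pi_ne_zero]
  have hfC : Integrable fun x : ℝ => (f x : ℂ) := hfint.ofReal
  have hinv := hfC.fourierInv_fourier_eq (v := (0 : ℝ))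
    (by rw [hF]; exact hμ.comp_mul_left' hpi) (Complex.continuous_ofReal.continuousAt.comp hfc)
  rw [hF, Real.fourierInv_eq'] at hinv
  simp only [inner_zero_right, mul_zero, Complex.ofReal_zero, zero_mul, Complex.exp_zero,
    one_smul] at hinv
  rw [Measure.integral_comp_mul_left (charFun μ)] at hinv
  rw [← hinv, Complex.real_smul, abs_inv, abs_neg, abs_of_pos (by positivity), one_div]

theorem endpointConstant_eq_integral_scaled (hp : 1 ≤ p) {k : ℕ} (hk : 1 ≤ k) :
    (endpointConstant p k : ℂ) =
      ((1 / (2 * Real.pi) : ℝ) : ℂ) * ∫ t : ℝ, genGaussianCharFun p (t / √(k : ℝ)) ^ k := by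
  have h0 : 0 < p := by linarith
  have := isFiniteMeasure_genGaussianMarginal h0 (chainDirection k k)
  have hc := funext (charFun_genGaussianMarginal_chainDirection h0 (le_refl k))
  have h := (isDensityValueAt_genGaussianMarginal_self hp hk).eq_integral_charFun
    (by rw [hc]
        exact (integrable_genGaussianCharFun_pow hp hk).comp_div (by positivity))
  rw [h, hc]

theorem endpointConstant_eq_integral_charFun (hp : 1 ≤ p) {k : ℕ} (hk : 1 ≤ k) :
    (endpointConstant p k : ℂ) =
      ((√(k : ℝ) / (2 * Real.pi) : ℝ) : ℂ) * ∫ ξ : ℝ, genGaussianCharFun p ξ ^ k := by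
  rw [endpointConstant_eq_integral_scaled hp hk,
    Measure.integral_comp_div (fun t => genGaussianCharFun p t ^ k), Complex.real_smul, ← mul_assoc,
    ← Complex.ofReal_mul, abs_of_nonneg (Real.sqrt_nonneg _), one_div_mul_eq_div]

end Fourier

/-! ### Gaussian mixtures and log-convexity of their cosine transforms. -/

section Laplace

/-- The function `h` is, on `[0, ∞)`, the Laplace transform of a finite measure on `[0, ∞)`. -/
def IsLaplaceTransform (h : ℝ → ℝ) : Prop :=
  ∃ μ : Measure ℝ, IsFiniteMeasure μ ∧ (∀ᵐ w ∂μ, 0 ≤ w) ∧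
    ∀ t, 0 ≤ t → h t = ∫ w, Real.exp (-(t * w)) ∂μ

theorem integrable_exp_neg_mul {μ : Measure ℝ} [IsFiniteMeasure μ] (hμ : ∀ᵐ w ∂μ, 0 ≤ w) {t : ℝ}
    (ht : 0 ≤ t) : Integrable (fun w => Real.exp (-(t * w))) μ := by
  refine (integrable_const (1 : ℝ)).mono' (by fun_prop) ?_
  filter_upwards [hμ] with w hw
  rw [Real.norm_of_nonneg (Real.exp_pos _).le, Real.exp_le_one_iff]
  nlinarith [mul_nonneg ht hw]

theorem IsLaplaceTransform.zero : IsLaplaceTransform fun _ => 0 :=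
  ⟨0, inferInstance, by simp, by simp⟩

theorem IsLaplaceTransform.one : IsLaplaceTransform fun _ => 1 :=
  ⟨Measure.dirac 0, inferInstance, by simp [ae_dirac_eq], by simp⟩

theorem IsLaplaceTransform.add {f g : ℝ → ℝ} (hf : IsLaplaceTransform f)
    (hg : IsLaplaceTransform g) : IsLaplaceTransform fun t => f t + g t := by
  obtain ⟨μ, hμ, hμ0, hf⟩ := hf
  obtain ⟨ν, hν, hν0, hg⟩ := hg
  refine ⟨μ + ν, inferInstance, ae_add_measure_iff.2 ⟨hμ0, hν0⟩, fun t ht => ?_⟩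
  simp only [hf t ht, hg t ht]
  rw [integral_add_measure (integrable_exp_neg_mul hμ0 ht)
    (integrable_exp_neg_mul hν0 ht)]

theorem IsLaplaceTransform.const_mul {f : ℝ → ℝ} (hf : IsLaplaceTransform f) {c : ℝ}
    (hc : 0 ≤ c) : IsLaplaceTransform fun t => c * f t := by
  obtain ⟨μ, hμ, hμ0, hf⟩ := hf
  refine ⟨ENNReal.ofReal c • μ, Measure.smul_finite μ ENNReal.ofReal_ne_top,
    Measure.ae_smul_measure hμ0 _, fun t ht => ?_⟩
  simp only [hf t ht]
  rw [integral_smul_measure, ENNReal.toReal_ofReal hc, smul_eq_mul]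

/-- The representing measure is the convolution of the two measures. -/
theorem IsLaplaceTransform.mul {f g : ℝ → ℝ} (hf : IsLaplaceTransform f)
    (hg : IsLaplaceTransform g) : IsLaplaceTransform fun t => f t * g t := by
  obtain ⟨μ, hμ, hμ0, hf⟩ := hf
  obtain ⟨ν, hν, hν0, hg⟩ := hg
  refine ⟨(μ.prod ν).map fun q => q.1 + q.2, inferInstance, ?_, fun t ht => ?_⟩
  · rw [ae_map_iff (by fun_prop) measurableSet_Ici]
    filter_upwards [Measure.quasiMeasurePreserving_fst.ae hμ0,
      Measure.quasiMeasurePreserving_snd.ae hν0] with q h1 h2 using add_nonneg h1 h2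
  · simp only [hf t ht, hg t ht]
    rw [integral_map (by fun_prop) (by fun_prop), ← integral_prod_mul]
    congr with q
    rw [← Real.exp_add]
    congr 1
    ring

theorem IsLaplaceTransform.pow {f : ℝ → ℝ} (hf : IsLaplaceTransform f) (j : ℕ) :
    IsLaplaceTransform fun t => f t ^ j := by
  induction j with
  | zero => simpa using IsLaplaceTransform.one
  | succ j ih => simpa only [pow_succ] using ih.mul hf

theorem IsLaplaceTransform.sum {f : ℕ → ℝ → ℝ} (hf : ∀ j, IsLaplaceTransform (f j)) (s : Finset ℕ) :
    IsLaplaceTransform fun t => ∑ j ∈ s, f j t := by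
  induction s using Finset.induction_on with
  | empty => simpa using IsLaplaceTransform.zero
  | insert a s ha ih => simpa only [Finset.sum_insert ha] using (hf a).add ih

/-- A form of log-convexity for the cosine transform, as a function of `ξ ^ 2`. -/
def HasLogConvexTransform (f : ℝ → ℝ) : Prop :=
  ∀ ξ, 0 ≤ cosTransform f ξ ∧ ∀ θ, 0 < θ → θ < 1 →
    cosTransform f (√θ * ξ) ≤ cosTransform f ξ ^ θ * cosTransform f 0 ^ (1 - θ)

/-- Only the inequality is carried to the limit, so no limit of mixing measures is needed. -/
theorem HasLogConvexTransform.of_tendsto {f : ℕ → ℝ → ℝ} {g bound : ℝ → ℝ}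
    (hf : ∀ j, HasLogConvexTransform (f j)) (hm : ∀ j, AEStronglyMeasurable (f j))
    (hb : Integrable bound) (hfb : ∀ j x, |f j x| ≤ bound x)
    (hlim : ∀ x, Tendsto (fun j => f j x) atTop (𝓝 (g x))) : HasLogConvexTransform g := by
  have ht : ∀ ξ, Tendsto (fun j => cosTransform (f j) ξ) atTop (𝓝 (cosTransform g ξ)) := by
    intro ξ
    refine tendsto_integral_of_dominated_convergence bound (fun j => ?_) hb (fun j => ?_) ?_
    · exact (by fun_prop : AEStronglyMeasurable fun x : ℝ => Real.cos (ξ * x)).mul (hm j)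
    · refine Eventually.of_forall fun x => ?_
      rw [norm_mul]
      exact (mul_le_of_le_one_left (norm_nonneg _) (Real.abs_cos_le_one _)).trans (hfb j x)
    · exact Eventually.of_forall fun x => (hlim x).const_mul _
  refine fun ξ => ⟨ge_of_tendsto' (ht ξ) fun j => (hf j ξ).1, fun θ h0 h1 => ?_⟩
  refine le_of_tendsto_of_tendsto' (ht _) (((ht ξ).rpow_const (Or.inr h0.le)).mul
    ((ht 0).rpow_const (Or.inr (by linarith)))) fun j => (hf j ξ).2 θ h0 h1

/-- Hölder's inequality with exponents `1/θ` and `1/(1-θ)`, from weighted AM-GM applied pointwise to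
`f / ∫ f` and `g / ∫ g`. -/
theorem integral_rpow_mul_rpow_le {α : Type*} [MeasurableSpace α] {μ : Measure α} {f g : α → ℝ}
    (hf : Integrable f μ) (hg : Integrable g μ) (hf0 : ∀ x, 0 ≤ f x) (hg0 : ∀ x, 0 ≤ g x) {θ : ℝ}
    (h0 : 0 < θ) (h1 : θ < 1) :
    ∫ x, f x ^ θ * g x ^ (1 - θ) ∂μ ≤ (∫ x, f x ∂μ) ^ θ * (∫ x, g x ∂μ) ^ (1 - θ) := by
  have hA := integral_nonneg (μ := μ) (f := f) hf0
  have hB := integral_nonneg (μ := μ) (f := g) hg0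
  rcases hA.eq_or_lt with hA0 | hA0
  · have : f =ᵐ[μ] 0 := (integral_eq_zero_iff_of_nonneg hf0 hf).1 hA0.symm
    rw [integral_eq_zero_of_ae]
    · exact mul_nonneg (Real.rpow_nonneg hA _) (Real.rpow_nonneg hB _)
    · filter_upwards [this] with x hx
      simp [hx, Real.zero_rpow h0.ne']
  rcases hB.eq_or_lt with hB0 | hB0
  · have : g =ᵐ[μ] 0 := (integral_eq_zero_iff_of_nonneg hg0 hg).1 hB0.symm
    rw [integral_eq_zero_of_ae]
    · exact mul_nonneg (Real.rpow_nonneg hA _) (Real.rpow_nonneg hB _)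
    · filter_upwards [this] with x hx
      simp [hx, Real.zero_rpow (by linarith : 1 - θ ≠ 0)]
  set A := ∫ x, f x ∂μ
  set B := ∫ x, g x ∂μ
  have hC : 0 < A ^ θ * B ^ (1 - θ) :=
    mul_pos (Real.rpow_pos_of_pos hA0 _) (Real.rpow_pos_of_pos hB0 _)
  have key : ∀ x, f x ^ θ * g x ^ (1 - θ) ≤
      A ^ θ * B ^ (1 - θ) * (θ / A * f x + (1 - θ) / B * g x) := by
    intro x
    have h := Real.geom_mean_le_arith_mean2_weighted h0.le (by linarith : 0 ≤ 1 - θ)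
      (div_nonneg (hf0 x) hA) (div_nonneg (hg0 x) hB) (by ring)
    rw [Real.div_rpow (hf0 x) hA, Real.div_rpow (hg0 x) hB, div_mul_div_comm,
      div_le_iff₀' hC] at h
    refine h.trans_eq ?_
    ring
  calc ∫ x, f x ^ θ * g x ^ (1 - θ) ∂μ
      ≤ ∫ x, A ^ θ * B ^ (1 - θ) * (θ / A * f x + (1 - θ) / B * g x) ∂μ := by
        refine integral_mono_of_nonneg (Eventually.of_forall fun x =>
          mul_nonneg (Real.rpow_nonneg (hf0 x) _) (Real.rpow_nonneg (hg0 x) _))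
          (((hf.const_mul _).add (hg.const_mul _)).const_mul _) (Eventually.of_forall key)
    _ = A ^ θ * B ^ (1 - θ) * (θ / A * A + (1 - θ) / B * B) := by
        rw [integral_const_mul, integral_add (hf.const_mul _) (hg.const_mul _),
          integral_const_mul, integral_const_mul]
    _ = A ^ θ * B ^ (1 - θ) := by
        rw [div_mul_cancel₀ _ hA0.ne', div_mul_cancel₀ _ hB0.ne']
        ring

theorem cosTransform_gaussian {b : ℝ} (hb : 0 < b) (ξ : ℝ) :
    cosTransform (fun x => Real.exp (-b * x ^ 2)) ξ =
      √(Real.pi / b) * Real.exp (-ξ ^ 2 / (4 * b)) := by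
  have h := integral_cexp_mul_eq_cosTransform (integrable_exp_neg_mul_sq hb) (by simp) ξ
  have h2 := fourierIntegral_gaussian (b := (b : ℂ)) (by simpa using hb) (ξ : ℂ)
  rw [← Complex.ofReal_inj, ← h]
  push_cast
  rw [h2, Real.sqrt_eq_rpow, Complex.ofReal_cpow (by positivity)]
  push_cast
  rfl

/-- Fubini over the mixture. The factor with `ε` gives integrability in `x`, and `|w|`, equal to `w`
almost everywhere, keeps every Gaussian exponent positive. -/
theorem IsLaplaceTransform.cosTransform_eq {h : ℝ → ℝ} {μ : Measure ℝ} [IsFiniteMeasure μ]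
    (hμ : ∀ᵐ w ∂μ, 0 ≤ w) (hh : ∀ t, 0 ≤ t → h t = ∫ w, Real.exp (-(t * w)) ∂μ) {ε : ℝ}
    (hε : 0 < ε) (ξ : ℝ) :
    cosTransform (fun x => Real.exp (-ε * x ^ 2) * h (x ^ 2)) ξ =
      ∫ w, √(Real.pi / (ε + |w|)) * Real.exp (-ξ ^ 2 / (4 * (ε + |w|))) ∂μ := by
  have hint : Integrable (fun q : ℝ × ℝ =>
      Real.cos (ξ * q.1) * Real.exp (-(ε + |q.2|) * q.1 ^ 2)) (volume.prod μ) := by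
    refine ((integrable_exp_neg_mul_sq hε).mul_prod (integrable_const (1 : ℝ))).mono'
      (by fun_prop) (Eventually.of_forall fun q => ?_)
    rw [norm_mul, mul_one, Real.norm_of_nonneg (Real.exp_pos _).le]
    refine (mul_le_of_le_one_left (Real.exp_pos _).le (Real.abs_cos_le_one _)).trans ?_
    rw [Real.exp_le_exp]
    nlinarith [mul_nonneg (abs_nonneg q.2) (sq_nonneg q.1)]
  have hsw := integral_integral_swap (f := fun x w : ℝ =>
    Real.cos (ξ * x) * Real.exp (-(ε + |w|) * x ^ 2)) hint
  calc cosTransform (fun x => Real.exp (-ε * x ^ 2) * h (x ^ 2)) ξ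
      = ∫ x, ∫ w, Real.cos (ξ * x) * Real.exp (-(ε + |w|) * x ^ 2) ∂μ := by
        rw [cosTransform]
        congr with x
        rw [hh _ (sq_nonneg x), integral_const_mul, ← integral_const_mul]
        congr 1
        refine integral_congr_ae ?_
        filter_upwards [hμ] with w hw
        rw [abs_of_nonneg hw, ← Real.exp_add]
        congr 1
        ring
    _ = ∫ w, cosTransform (fun x => Real.exp (-(ε + |w|) * x ^ 2)) ξ ∂μ := hsw
    _ = _ := by
        congr with w
        rw [cosTransform_gaussian (by positivity)]

/-- The logarithm of a single Gaussian transform is affine in `ξ ^ 2`, so the inequality is an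
equality for each `w`; Hölder in `w` then gives it for the mixture. -/
theorem IsLaplaceTransform.hasLogConvexTransform {h : ℝ → ℝ} (hh : IsLaplaceTransform h) {ε : ℝ}
    (hε : 0 < ε) : HasLogConvexTransform fun x => Real.exp (-ε * x ^ 2) * h (x ^ 2) := by
  obtain ⟨μ, hμ, hμ0, hh⟩ := hh
  intro ξ
  simp only [IsLaplaceTransform.cosTransform_eq hμ0 hh hε]
  refine ⟨integral_nonneg fun w => by positivity, fun θ h0 h1 => ?_⟩
  have hint : ∀ ζ : ℝ, Integrable
      (fun w => √(Real.pi / (ε + |w|)) * Real.exp (-ζ ^ 2 / (4 * (ε + |w|)))) μ := by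
    intro ζ
    refine (integrable_const (√(Real.pi / ε))).mono'
      (Measurable.aestronglyMeasurable (by fun_prop)) (Eventually.of_forall fun w => ?_)
    rw [Real.norm_of_nonneg (by positivity)]
    refine (mul_le_of_le_one_right (by positivity) ?_).trans ?_
    · rw [Real.exp_le_one_iff, neg_div, neg_nonpos]
      positivity
    · refine Real.sqrt_le_sqrt ?_
      gcongr
      linarith [abs_nonneg w]
  refine le_trans (le_of_eq ?_) (integral_rpow_mul_rpow_le (hint ξ) (hint 0)
    (fun w => by positivity) (fun w => by positivity) h0 h1)
  congr with w
  set a := √(Real.pi / (ε + |w|))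
  have ha : 0 < a := Real.sqrt_pos.2 (by positivity)
  rw [Real.mul_rpow ha.le (Real.exp_pos _).le, ← Real.exp_mul]
  simp only [ne_eq, OfNat.ofNat_ne_zero, not_false_eq_true, zero_pow, neg_zero, zero_div,
    Real.exp_zero, mul_one]
  rw [mul_right_comm, ← Real.rpow_add ha, mul_pow, Real.sq_sqrt h0.le, add_sub_cancel,
    Real.rpow_one]
  congr 2
  ring

end Laplace

/-! ### Approximating `exp (-|x| ^ p)` by Gaussian mixtures. -/

section Stable

variable {α : ℝ}

/-- The integrand in the Lévy representation of `t ^ α`. -/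
noncomputable def levyIntegrand (α t w : ℝ) : ℝ := (1 - Real.exp (-(t * w))) * w ^ (-1 - α)

theorem levyIntegrand_nonneg {t w : ℝ} (ht : 0 ≤ t) (hw : 0 < w) : 0 ≤ levyIntegrand α t w := by
  refine mul_nonneg ?_ (Real.rpow_nonneg hw.le _)
  rw [sub_nonneg, Real.exp_le_one_iff]
  nlinarith [mul_nonneg ht hw.le]

/-- Near `0` the bound `1 - exp (-(t w)) ≤ t w` leaves `w ^ (-α)`, integrable as `α < 1`; at
infinity the bound `1` suffices as `α > 0`. -/
theorem integrableOn_levyIntegrand (h0 : 0 < α) (h1 : α < 1) {t : ℝ} (ht : 0 ≤ t) :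
    IntegrableOn (levyIntegrand α t) (Set.Ioi 0) := by
  have hm : Measurable (levyIntegrand α t) := by
    unfold levyIntegrand
    fun_prop
  rw [← Set.Ioc_union_Ioi_eq_Ioi zero_le_one]
  refine IntegrableOn.union ?_ ?_
  · have hi : IntegrableOn (fun w : ℝ => t * w ^ (-α)) (Set.Ioc 0 1) :=
      ((intervalIntegrable_iff_integrableOn_Ioc_of_le zero_le_one).1
        (intervalIntegral.intervalIntegrable_rpow' (by linarith))).const_mul t
    refine hi.mono' hm.aestronglyMeasurable ((ae_restrict_iff' measurableSet_Ioc).2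
      (Eventually.of_forall fun w hw => ?_))
    rw [Real.norm_of_nonneg (levyIntegrand_nonneg ht hw.1), levyIntegrand,
      show -α = 1 + (-1 - α) by ring, Real.rpow_add hw.1, Real.rpow_one, ← mul_assoc]
    refine mul_le_mul_of_nonneg_right ?_ (Real.rpow_nonneg hw.1.le _)
    linarith [Real.add_one_le_exp (-(t * w))]
  · refine (integrableOn_Ioi_rpow_of_lt (by linarith : -1 - α < -1) one_pos).mono'
      hm.aestronglyMeasurable ((ae_restrict_iff' measurableSet_Ioi).2
      (Eventually.of_forall fun w hw => ?_))
    have hw0 : 0 < w := one_pos.trans hw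
    rw [Real.norm_of_nonneg (levyIntegrand_nonneg ht hw0), levyIntegrand]
    refine mul_le_of_le_one_left (Real.rpow_nonneg hw0.le _) ?_
    linarith [Real.exp_pos (-(t * w))]

theorem integral_levyIntegrand_pos (h0 : 0 < α) (h1 : α < 1) :
    0 < ∫ w in Set.Ioi 0, levyIntegrand α 1 w := by
  rw [setIntegral_pos_iff_support_of_nonneg_ae ((ae_restrict_iff' measurableSet_Ioi).2
    (Eventually.of_forall fun w hw => levyIntegrand_nonneg zero_le_one hw))
    (integrableOn_levyIntegrand h0 h1 zero_le_one)]
  have : Set.Ioi (0 : ℝ) ⊆ Function.support (levyIntegrand α 1) ∩ Set.Ioi 0 := by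
    refine fun w hw => ⟨ne_of_gt (mul_pos ?_ (Real.rpow_pos_of_pos hw _)), hw⟩
    rw [sub_pos, Real.exp_lt_one_iff, one_mul, neg_lt_zero]
    exact hw
  refine lt_of_lt_of_le ?_ (measure_mono this)
  simp

/-- Scaling: substitute `t w` for `w` in the integral at `t = 1`. -/
theorem integral_levyIntegrand (h0 : 0 < α) {t : ℝ} (ht : 0 ≤ t) :
    ∫ w in Set.Ioi 0, levyIntegrand α t w =
      t ^ α * ∫ w in Set.Ioi 0, levyIntegrand α 1 w := by
  rcases ht.eq_or_lt with rfl | ht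
  · simp [levyIntegrand, Real.zero_rpow h0.ne']
  have h := integral_comp_mul_left_Ioi (levyIntegrand α 1) 0 ht
  have h2 : ∫ w in Set.Ioi 0, levyIntegrand α 1 (t * w) =
      ∫ w in Set.Ioi 0, t ^ (-1 - α) * levyIntegrand α t w := by
    refine setIntegral_congr_fun measurableSet_Ioi fun w hw => ?_
    simp only [levyIntegrand]
    rw [Real.mul_rpow ht.le (le_of_lt hw), one_mul]
    ring
  rw [h2, integral_const_mul, mul_zero, smul_eq_mul, ← Real.rpow_neg_one] at h
  have h3 : t ^ α * t ^ (-1 : ℝ) * t ^ (1 : ℝ) = t ^ α := by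
    rw [← Real.rpow_add ht, ← Real.rpow_add ht]
    congr 1
    ring
  have h4 : t ^ α * t ^ (1 : ℝ) * t ^ (-1 - α) = 1 := by
    rw [← Real.rpow_add ht, ← Real.rpow_add ht, ← Real.rpow_zero t]
    congr 1
    ring
  calc _ = t ^ α * t ^ (1 : ℝ) * t ^ (-1 - α) * ∫ w in Set.Ioi 0, levyIntegrand α t w := by
        rw [h4, one_mul]
    _ = t ^ α * t ^ (1 : ℝ) * (t ^ (-1 - α) * ∫ w in Set.Ioi 0, levyIntegrand α t w) := by ring
    _ = t ^ α * t ^ (-1 : ℝ) * t ^ (1 : ℝ) * ∫ w in Set.Ioi 0, levyIntegrand α 1 w := by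
        rw [h]
        ring
    _ = _ := by rw [h3]

/-- The Laplace transform of the Lévy measure truncated at `a`. -/
noncomputable def truncatedLevy (α a t : ℝ) : ℝ :=
  ∫ w in Set.Ioi a, w ^ (-1 - α) * Real.exp (-(t * w))

theorem isLaplaceTransform_truncatedLevy (h0 : 0 < α) {a : ℝ} (ha : 0 < a) :
    IsLaplaceTransform (truncatedLevy α a) := by
  have hi := integrableOn_Ioi_rpow_of_lt (by linarith : -1 - α < -1) ha
  refine ⟨(volume.restrict (Set.Ioi a)).withDensity fun w => ENNReal.ofReal (w ^ (-1 - α)),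
    isFiniteMeasure_withDensity_ofReal hi.2, ?_, fun t ht => ?_⟩
  · refine (withDensity_absolutelyContinuous _ _).ae_le ?_
    exact (ae_restrict_iff' measurableSet_Ioi).2 (Eventually.of_forall fun _ hw => (ha.trans hw).le)
  · rw [integral_withDensity_eq_integral_toReal_smul (by fun_prop)
      (Eventually.of_forall fun _ => ENNReal.ofReal_lt_top)]
    refine setIntegral_congr_fun measurableSet_Ioi fun w hw => ?_
    have hw0 : 0 < w := ha.trans hw
    simp only [smul_eq_mul]
    rw [ENNReal.toReal_ofReal (Real.rpow_nonneg hw0.le _)]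

theorem truncatedLevy_nonneg {a : ℝ} (ha : 0 < a) (t : ℝ) : 0 ≤ truncatedLevy α a t :=
  setIntegral_nonneg measurableSet_Ioi fun _ hw =>
    mul_nonneg (Real.rpow_nonneg (ha.trans hw).le _) (Real.exp_pos _).le

theorem truncatedLevy_zero_sub (h0 : 0 < α) {a t : ℝ} (ha : 0 < a) (ht : 0 ≤ t) :
    truncatedLevy α a 0 - truncatedLevy α a t = ∫ w in Set.Ioi a, levyIntegrand α t w := by
  have hi := integrableOn_Ioi_rpow_of_lt (by linarith : -1 - α < -1) ha
  have hi2 : ∀ s, 0 ≤ s →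
      IntegrableOn (fun w : ℝ => w ^ (-1 - α) * Real.exp (-(s * w))) (Set.Ioi a) := by
    intro s hs
    refine hi.mono' (by fun_prop) ((ae_restrict_iff' measurableSet_Ioi).2
      (Eventually.of_forall fun w hw => ?_))
    have hw0 : 0 < w := ha.trans hw
    have := Real.rpow_nonneg hw0.le (-1 - α)
    rw [Real.norm_of_nonneg (by positivity)]
    refine mul_le_of_le_one_right this ?_
    rw [Real.exp_le_one_iff]
    nlinarith [mul_nonneg hs hw0.le]
  rw [truncatedLevy, truncatedLevy, ← integral_sub (hi2 0 le_rfl) (hi2 t ht)]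
  congr with w
  rw [levyIntegrand, zero_mul, neg_zero, Real.exp_zero]
  ring

/-- The partial sums of `exp (-l) * ∑ m ^ j / j!` are Laplace transforms, and they are at most `1`
because `m ≤ l`. -/
theorem hasLogConvexTransform_compoundPoisson {m : ℝ → ℝ} (hm : IsLaplaceTransform m)
    (hm0 : ∀ t, 0 ≤ m t) {l : ℝ} (hl : ∀ t, 0 ≤ t → m t ≤ l) {ε : ℝ} (hε : 0 < ε)
    (hmeas : Measurable m) :
    HasLogConvexTransform fun x => Real.exp (-ε * x ^ 2) * Real.exp (-(l - m (x ^ 2))) := by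
  have hL : ∀ J : ℕ, IsLaplaceTransform fun t =>
      Real.exp (-l) * ∑ j ∈ Finset.range J, (j.factorial : ℝ)⁻¹ * m t ^ j := fun J =>
    (IsLaplaceTransform.sum (fun j => (hm.pow j).const_mul (by positivity)) _).const_mul
      (Real.exp_pos _).le
  refine HasLogConvexTransform.of_tendsto (bound := fun x => Real.exp (-ε * x ^ 2))
    (fun J => (hL J).hasLogConvexTransform hε) (fun J => ?_) (integrable_exp_neg_mul_sq hε)
    (fun J x => ?_) fun x => ?_
  · exact Measurable.aestronglyMeasurable (by fun_prop)
  · have hs : ∑ j ∈ Finset.range J, (j.factorial : ℝ)⁻¹ * m (x ^ 2) ^ j ≤ Real.exp l := by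
      simp only [inv_mul_eq_div]
      exact (Real.sum_le_exp_of_nonneg (hm0 _) J).trans (Real.exp_le_exp.2 (hl _ (sq_nonneg x)))
    have hs0 : 0 ≤ ∑ j ∈ Finset.range J, (j.factorial : ℝ)⁻¹ * m (x ^ 2) ^ j :=
      Finset.sum_nonneg fun j _ => mul_nonneg (by positivity) (pow_nonneg (hm0 _) _)
    rw [abs_of_nonneg (by positivity)]
    refine mul_le_of_le_one_right (Real.exp_pos _).le ?_
    calc _ ≤ Real.exp (-l) * Real.exp l := mul_le_mul_of_nonneg_left hs (Real.exp_pos _).le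
      _ = 1 := by rw [← Real.exp_add, neg_add_cancel, Real.exp_zero]
  · have h := (NormedSpace.expSeries_div_hasSum_exp (m (x ^ 2))).tendsto_sum_nat
    rw [← Real.exp_eq_exp_ℝ] at h
    simp only [← inv_mul_eq_div] at h
    have h2 := (h.const_mul (Real.exp (-l))).const_mul (Real.exp (-ε * x ^ 2))
    rwa [← Real.exp_add, show -l + m (x ^ 2) = -(l - m (x ^ 2)) by ring] at h2

/-- The Lévy measure, normalized by `c`, is truncated at `1 / (N + 1)` to make it finite; as `N → ∞`
the compound Poisson exponents tend to `(x ^ 2) ^ α`. -/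
theorem hasLogConvexTransform_exp_neg_sq_rpow (h0 : 0 < α) (h1 : α < 1) {ε : ℝ} (hε : 0 < ε) :
    HasLogConvexTransform fun x => Real.exp (-ε * x ^ 2) * Real.exp (-(x ^ 2) ^ α) := by
  set c := ∫ w in Set.Ioi 0, levyIntegrand α 1 w with hc
  have hcpos : 0 < c := integral_levyIntegrand_pos h0 h1
  set a : ℕ → ℝ := fun N => 1 / ((N : ℝ) + 1)
  have ha : ∀ N, 0 < a N := fun N => by positivity
  have hq : ∀ N t, 0 ≤ t → c⁻¹ * truncatedLevy α (a N) 0 - c⁻¹ * truncatedLevy α (a N) t =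
      c⁻¹ * ∫ w in Set.Ioi (a N), levyIntegrand α t w := by
    intro N t ht
    rw [← mul_sub, truncatedLevy_zero_sub h0 (ha N) ht]
  have hq0 : ∀ N t, 0 ≤ t → 0 ≤ c⁻¹ * ∫ w in Set.Ioi (a N), levyIntegrand α t w :=
    fun N t ht => mul_nonneg (inv_pos.2 hcpos).le (setIntegral_nonneg measurableSet_Ioi
      fun w hw => levyIntegrand_nonneg ht ((ha N).trans hw))
  have hmeas : ∀ N, Measurable (truncatedLevy α (a N)) := by
    intro N
    have : StronglyMeasurable fun q : ℝ × ℝ => q.2 ^ (-1 - α) * Real.exp (-(q.1 * q.2)) :=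
      Measurable.stronglyMeasurable (by fun_prop)
    exact this.integral_prod_right.measurable
  refine HasLogConvexTransform.of_tendsto (bound := fun x => Real.exp (-ε * x ^ 2))
    (fun N => hasLogConvexTransform_compoundPoisson (l := c⁻¹ * truncatedLevy α (a N) 0)
      ((isLaplaceTransform_truncatedLevy h0 (ha N)).const_mul (inv_pos.2 hcpos).le)
      (fun t => mul_nonneg (inv_pos.2 hcpos).le (truncatedLevy_nonneg (ha N) t))
      (fun t ht => sub_nonneg.1 (hq N t ht ▸ hq0 N t ht)) hε ((hmeas N).const_mul _))
    (fun N => ?_) (integrable_exp_neg_mul_sq hε) (fun N x => ?_) fun x => ?_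
  · have := hmeas N
    exact Measurable.aestronglyMeasurable (by fun_prop)
  · rw [abs_of_nonneg (by positivity)]
    refine mul_le_of_le_one_right (Real.exp_pos _).le ?_
    rw [Real.exp_le_one_iff, hq N _ (sq_nonneg x), neg_nonpos]
    exact hq0 N _ (sq_nonneg x)
  · simp only [hq _ _ (sq_nonneg x)]
    refine Tendsto.const_mul _ (Real.continuous_exp.continuousAt.tendsto.comp (Tendsto.neg ?_))
    have hcov : AECover (volume.restrict (Set.Ioi (0 : ℝ))) atTop fun N => Set.Ioi (a N) :=
      aecover_Ioi_of_Ioi tendsto_one_div_add_atTop_nhds_zero_nat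
    have ht := hcov.integral_tendsto_of_countably_generated
      (integrableOn_levyIntegrand h0 h1 (sq_nonneg x))
    rw [integral_levyIntegrand h0 (sq_nonneg x)] at ht
    have ht2 := ht.const_mul c⁻¹
    rw [mul_left_comm, ← hc, inv_mul_cancel₀ hcpos.ne', mul_one] at ht2
    refine ht2.congr fun N => ?_
    rw [Measure.restrict_restrict measurableSet_Ioi,
      Set.inter_eq_left.2 (Set.Ioi_subset_Ioi (ha N).le)]

theorem hasLogConvexTransform_exp_neg_abs_rpow {p : ℝ} (h0 : 0 < p) (h2 : p < 2) :
    HasLogConvexTransform fun x => Real.exp (-|x| ^ p) := by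
  have heq : ∀ x : ℝ, (x ^ 2) ^ (p / 2) = |x| ^ p := by
    intro x
    rw [← sq_abs, ← Real.rpow_natCast, ← Real.rpow_mul (abs_nonneg x)]
    congr 1
    push_cast
    ring
  refine HasLogConvexTransform.of_tendsto (bound := fun x => Real.exp (-|x| ^ p))
    (fun N => hasLogConvexTransform_exp_neg_sq_rpow (α := p / 2) (ε := 1 / ((N : ℝ) + 1))
      (by linarith) (by linarith) (by positivity))
    (fun N => Measurable.aestronglyMeasurable (by fun_prop)) (integrable_exp_neg_abs_rpow h0)
    (fun N x => ?_) fun x => ?_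
  · rw [abs_of_nonneg (by positivity), heq]
    refine mul_le_of_le_one_left (Real.exp_pos _).le ?_
    rw [Real.exp_le_one_iff, neg_mul, neg_nonpos]
    positivity
  · simp only [heq]
    have h := (tendsto_one_div_add_atTop_nhds_zero_nat (𝕜 := ℝ)).neg.mul_const (x ^ 2)
    rw [neg_zero, zero_mul] at h
    simpa using (Real.continuous_exp.continuousAt.tendsto.comp h).mul_const (Real.exp (-|x| ^ p))

end Stable

/-! ### Strict monotonicity and the exclusion of equality. -/

section Chain

variable {p : ℝ}

theorem cosTransform_const_mul (f : ℝ → ℝ) (c ξ : ℝ) :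
    cosTransform (fun x => c * f x) ξ = c * cosTransform f ξ := by
  simp only [cosTransform, mul_left_comm]
  exact integral_const_mul _ _

theorem HasLogConvexTransform.const_mul {f : ℝ → ℝ} (hf : HasLogConvexTransform f) {c : ℝ}
    (hc : 0 < c) : HasLogConvexTransform fun x => c * f x := by
  intro ξ
  simp only [cosTransform_const_mul]
  refine ⟨mul_nonneg hc.le (hf ξ).1, fun θ h0 h1 => ?_⟩
  rw [Real.mul_rpow hc.le (hf ξ).1, Real.mul_rpow hc.le (hf 0).1, mul_mul_mul_comm,
    ← Real.rpow_add hc, add_sub_cancel, Real.rpow_one]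
  exact mul_le_mul_of_nonneg_left ((hf ξ).2 θ h0 h1) hc.le

theorem cosTransform_genGaussianPDF_zero (hp : 0 < p) : cosTransform (genGaussianPDF p) 0 = 1 := by
  have h := genGaussianCharFun_eq_cosTransform hp 0
  rw [genGaussianCharFun_zero hp] at h
  exact_mod_cast h.symm

theorem cosTransform_neg (f : ℝ → ℝ) (ξ : ℝ) : cosTransform f (-ξ) = cosTransform f ξ := by
  simp [cosTransform]

theorem hasLogConvexTransform_genGaussianPDF (h0 : 0 < p) (h2 : p < 2) :
    HasLogConvexTransform (genGaussianPDF p) := by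
  have h := (hasLogConvexTransform_exp_neg_abs_rpow h0 h2).const_mul
    (inv_pos.2 (two_mul_Gamma_pos h0))
  simp only [inv_mul_eq_div] at h
  exact h

theorem cosTransform_genGaussianPDF_le (h0 : 0 < p) (h2 : p < 2) {θ : ℝ} (hθ : 0 < θ) (hθ1 : θ < 1)
    (ξ : ℝ) :
    cosTransform (genGaussianPDF p) (√θ * ξ) ≤ cosTransform (genGaussianPDF p) ξ ^ θ := by
  have h := (hasLogConvexTransform_genGaussianPDF h0 h2 ξ).2 θ hθ hθ1
  rwa [cosTransform_genGaussianPDF_zero h0, Real.one_rpow, mul_one] at h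

/-- The densities `g_p` with `p < 2` are not Gaussian. -/
theorem genGaussian_ne_gaussianReal (h0 : 0 < p) (h2 : p < 2) (v : NNReal) :
    genGaussian p ≠ gaussianReal 0 v := by
  intro h
  rcases eq_or_ne v 0 with rfl | hv
  · rw [gaussianReal_zero_var] at h
    have h1 : genGaussian p {0} = 0 :=
      withDensity_absolutelyContinuous volume _ Real.volume_singleton
    rw [h] at h1
    simp at h1
  have hpdf : ∀ x, genGaussianPDF p x = gaussianPDFReal 0 v x := by
    intro x
    have e1 : IsDensityValueAt (genGaussian p) x (genGaussianPDF p x) :=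
      ⟨_, (continuous_genGaussianPDF h0.le).measurable, fun y => (genGaussianPDF_pos h0 y).le, rfl,
        (continuous_genGaussianPDF h0.le).continuousAt, rfl⟩
    refine e1.unique ⟨_, measurable_gaussianPDFReal 0 v, gaussianPDFReal_nonneg 0 v, ?_, ?_, rfl⟩
    · rw [h, gaussianReal_of_var_ne_zero 0 hv]
      rfl
    · unfold gaussianPDFReal
      exact Continuous.continuousAt (by fun_prop)
  have hv0 : (0 : ℝ) < v := by positivity
  have hx : ∀ x : ℝ, |x| ^ p = x ^ 2 / (2 * v) := by
    have hzero := hpdf 0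
    simp only [genGaussianPDF, gaussianPDFReal, abs_zero, Real.zero_rpow h0.ne', neg_zero,
      Real.exp_zero, sub_zero, ne_eq, OfNat.ofNat_ne_zero, not_false_eq_true, zero_pow, zero_div,
      mul_one] at hzero
    intro x
    have h3 := hpdf x
    simp only [genGaussianPDF, gaussianPDFReal, sub_zero] at h3
    rw [← hzero, div_eq_mul_one_div, mul_comm] at h3
    have h4 := mul_left_cancel₀ (one_div_pos.2 (two_mul_Gamma_pos h0)).ne' h3
    rw [Real.exp_eq_exp, neg_div] at h4
    exact neg_injective h4
  -- The points `1` and `2` give `2 ^ p = 2 ^ 2`, contradicting `p < 2`.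
  have e1 := hx 1
  have e2 := hx 2
  rw [abs_one, Real.one_rpow, one_pow] at e1
  rw [div_eq_mul_one_div, ← e1, mul_one, abs_two, ← Real.rpow_natCast] at e2
  have := (Real.rpow_right_inj (by norm_num) (by norm_num)).1 e2
  push_cast at this
  linarith

/-- An identity `φ (√r ξ) = φ ξ ^ r` can only hold for a Gaussian. -/
theorem exists_cosTransform_genGaussianPDF_lt (h0 : 0 < p) (h2 : p < 2) {r : ℝ} (hr : 0 < r)
    (hr1 : r < 1) :
    ∃ ξ, cosTransform (genGaussianPDF p) (√r * ξ) < cosTransform (genGaussianPDF p) ξ ^ r := by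
  by_contra! hcon
  set φ := cosTransform (genGaussianPDF p) with hφ
  have hφ0 : ∀ ξ, 0 ≤ φ ξ := fun ξ => (hasLogConvexTransform_genGaussianPDF h0 h2 ξ).1
  have hle : ∀ θ, 0 < θ → θ < 1 → ∀ ξ, φ (√θ * ξ) ≤ φ ξ ^ θ :=
    fun θ h h' ξ => cosTransform_genGaussianPDF_le h0 h2 h h' ξ
  have heq : ∀ ξ, φ (√r * ξ) = φ ξ ^ r := fun ξ => (hle r hr hr1 ξ).antisymm (hcon ξ)
  have hcont : Continuous φ := continuous_cosTransform (integrable_genGaussianPDF h0)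
  have hone : φ 0 = 1 := cosTransform_genGaussianPDF_zero h0
  have hle1 : ∀ ξ, φ ξ ≤ 1 := by
    intro ξ
    have h := norm_genGaussianCharFun_le_one h0 ξ
    rw [genGaussianCharFun_eq_cosTransform h0, Complex.norm_real] at h
    exact (le_abs_self _).trans h
  -- Log-convexity in `ξ ^ 2` with `φ 0 = 1`, taken at `θ = (s / t) ^ 2`.
  have hmono : ∀ s t : ℝ, 0 < s → s ≤ t → φ s ^ (1 / s ^ 2) ≤ φ t ^ (1 / t ^ 2) := by
    intro s t hs hst
    rcases hst.eq_or_lt with rfl | hst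
    · exact le_rfl
    have ht : 0 < t := hs.trans hst
    have hq : s / t < 1 := (div_lt_one ht).2 hst
    have h := hle ((s / t) ^ 2) (by positivity) (pow_lt_one₀ (by positivity) hq two_ne_zero) t
    rw [Real.sqrt_sq (by positivity), div_mul_cancel₀ _ ht.ne'] at h
    refine (Real.rpow_le_rpow (hφ0 s) h (by positivity)).trans_eq ?_
    rw [← Real.rpow_mul (hφ0 t)]
    congr 1
    field_simp
  have hiter : ∀ (t : ℝ) (m : ℕ), φ (√r ^ m * t) = φ t ^ (r ^ m) := by
    intro t m
    induction m with
    | zero => simp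
    | succ m ih => rw [pow_succ', mul_assoc, heq, ih, ← Real.rpow_mul (hφ0 t), pow_succ]
  -- The assumed identity makes this quantity invariant under scaling by `√r < 1`. Moving `t` below
  -- `s` by iterated scaling reverses the monotonicity.
  have hconst : ∀ s t : ℝ, 0 < s → s ≤ t → φ s ^ (1 / s ^ 2) = φ t ^ (1 / t ^ 2) := by
    intro s t hs hst
    have ht : 0 < t := hs.trans_le hst
    refine (hmono s t hs hst).antisymm ?_
    have hsr : √r < 1 := by
      rw [Real.sqrt_lt' one_pos]
      simpa using hr1
    obtain ⟨m, hm⟩ := exists_pow_lt_of_lt_one (div_pos hs ht) hsr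
    rw [lt_div_iff₀ ht] at hm
    have hsr0 : 0 < √r := Real.sqrt_pos.2 hr
    refine le_of_eq_of_le ?_ (hmono (√r ^ m * t) s (by positivity) hm.le)
    rw [hiter, ← Real.rpow_mul (hφ0 t), mul_pow, ← pow_mul, mul_comm m 2, pow_mul,
      Real.sq_sqrt hr.le]
    congr 1
    field_simp
  have hpow : ∀ s : ℝ, 0 < s → φ s = φ 1 ^ (s ^ 2) := by
    intro s hs
    have h : φ s ^ (1 / s ^ 2) = φ 1 := by
      rcases le_total s 1 with h | h
      · rw [hconst s 1 hs h]
        simp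
      · rw [← hconst 1 s one_pos h]
        simp
    rw [← h, ← Real.rpow_mul (hφ0 s), one_div_mul_cancel (by positivity), Real.rpow_one]
  have hpos : 0 < φ 1 := by
    refine (hφ0 1).lt_of_ne fun h => ?_
    have ht : Tendsto φ (𝓝[>] 0) (𝓝 1) := hone ▸ hcont.continuousAt.continuousWithinAt.tendsto
    have ht0 : Tendsto φ (𝓝[>] 0) (𝓝 0) := by
      refine tendsto_const_nhds.congr' ?_
      filter_upwards [self_mem_nhdsWithin] with s hs
      rw [hpow s hs, ← h, Real.zero_rpow (ne_of_gt (pow_pos hs 2))]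
    exact one_ne_zero (tendsto_nhds_unique ht ht0)
  -- The variance for which `φ 1 ^ (t ^ 2) = exp (-v t ^ 2 / 2)`.
  set v : NNReal := ⟨-(2 * Real.log (φ 1)), by
    have := Real.log_nonpos (hφ0 1) (hle1 1)
    linarith⟩ with hv
  refine genGaussian_ne_gaussianReal h0 h2 v ?_
  have := isProbabilityMeasure_genGaussian h0
  refine Measure.ext_of_charFun (funext fun t => ?_)
  have hall : φ t = φ 1 ^ (t ^ 2) := by
    rcases lt_trichotomy t 0 with h | rfl | h
    · have := hpow (-t) (neg_pos.2 h)
      rwa [hφ, cosTransform_neg, neg_sq] at this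
    · simp [hone]
    · exact hpow t h
  rw [charFun_genGaussian h0, charFun_gaussianReal, genGaussianCharFun_eq_cosTransform h0, ← hφ,
    hall, Real.rpow_def_of_pos hpos]
  have hvv : (v : ℝ) = -(2 * Real.log (φ 1)) := rfl
  rw [hvv]
  push_cast
  congr 1
  ring

theorem endpointConstant_eq_integral_cosTransform (hp : 1 ≤ p) {k : ℕ} (hk : 1 ≤ k) :
    endpointConstant p k =
      1 / (2 * Real.pi) * ∫ t : ℝ, cosTransform (genGaussianPDF p) (t / √(k : ℝ)) ^ k := by
  have h := endpointConstant_eq_integral_scaled hp hk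
  simp only [genGaussianCharFun_eq_cosTransform (by linarith : 0 < p), ← Complex.ofReal_pow] at h
  rw [integral_complex_ofReal, ← Complex.ofReal_mul] at h
  exact_mod_cast h

theorem integrable_cosTransform_genGaussianPDF_pow (hp : 1 ≤ p) {k : ℕ} (hk : 1 ≤ k) :
    Integrable fun t : ℝ => cosTransform (genGaussianPDF p) (t / √(k : ℝ)) ^ k := by
  have h := ((integrable_genGaussianCharFun_pow hp hk).comp_div
    (by positivity : √(k : ℝ) ≠ 0)).re
  refine h.congr (Eventually.of_forall fun t => ?_)
  simp only [genGaussianCharFun_eq_cosTransform (by linarith : 0 < p), ← Complex.ofReal_pow]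
  rfl

theorem endpointConstant_succ_lt (hp : 1 ≤ p) (h2 : p < 2) {k : ℕ} (hk : 1 ≤ k) :
    endpointConstant p (k + 1) < endpointConstant p k := by
  have h0 : 0 < p := by linarith
  set φ := cosTransform (genGaussianPDF p) with hφ
  have hφ0 : ∀ ξ, 0 ≤ φ ξ := fun ξ => (hasLogConvexTransform_genGaussianPDF h0 h2 ξ).1
  have hcont : Continuous φ := continuous_cosTransform (integrable_genGaussianPDF h0)
  have hk0 : (0 : ℝ) < k := by positivity
  -- With this ratio `t / √(k+1) = √r * (t / √k)`, and the exponent `r * (k + 1)` equals `k`.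
  set r : ℝ := k / (k + 1) with hr
  have hr0 : 0 < r := by positivity
  have hr1 : r < 1 := (div_lt_one (by positivity)).2 (by linarith)
  have hscale : ∀ t : ℝ, t / √((k + 1 : ℕ) : ℝ) = √r * (t / √(k : ℝ)) := by
    intro t
    rw [hr, Real.sqrt_div hk0.le]
    push_cast
    have : √(k : ℝ) ≠ 0 := by positivity
    field_simp
  have hpow : ∀ ξ, (φ ξ ^ r) ^ (k + 1) = φ ξ ^ k := by
    intro ξ
    rw [← Real.rpow_natCast, ← Real.rpow_mul (hφ0 ξ), ← Real.rpow_natCast]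
    congr 1
    push_cast
    rw [hr, div_mul_cancel₀ _ (by positivity)]
  have hle : (fun t : ℝ => φ (t / √((k + 1 : ℕ) : ℝ)) ^ (k + 1)) ≤
      fun t : ℝ => φ (t / √(k : ℝ)) ^ k := by
    intro t
    simp only
    rw [hscale, ← hpow]
    exact pow_le_pow_left₀ (hφ0 _) (cosTransform_genGaussianPDF_le h0 h2 hr0 hr1 _) _
  have hi1 := integrable_cosTransform_genGaussianPDF_pow hp (Nat.succ_le_succ (Nat.zero_le k))
  have hi2 := integrable_cosTransform_genGaussianPDF_pow hp hk
  rw [endpointConstant_eq_integral_cosTransform hp hk,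
    endpointConstant_eq_integral_cosTransform hp (Nat.succ_le_succ (Nat.zero_le k))]
  refine mul_lt_mul_of_pos_left ((integral_mono hi1 hi2 hle).lt_of_ne fun heq => ?_) (by positivity)
  -- Equal integrals of ordered functions agree almost everywhere, and by continuity everywhere,
  -- which contradicts the strict inequality at some `ξ`.
  have hae := (integral_eq_iff_of_ae_le hi1 hi2 (Eventually.of_forall hle)).1 heq
  have hfun := (Continuous.ae_eq_iff_eq volume
    ((hcont.comp (continuous_id.div_const _)).pow _)
    ((hcont.comp (continuous_id.div_const _)).pow _)).1 hae
  obtain ⟨ξ, hξ⟩ := exists_cosTransform_genGaussianPDF_lt h0 h2 hr0 hr1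
  have h := congrFun hfun (ξ * √(k : ℝ))
  simp only [Nat.succ_eq_add_one, Pi.pow_apply, Function.comp_apply, id] at h
  rw [hscale, mul_div_cancel_right₀ _ (by positivity), ← hpow] at h
  exact absurd h (pow_lt_pow_left₀ hξ (hφ0 _) (Nat.succ_ne_zero k)).ne

end Chain

theorem mainTheorem6 :
    -- endpoint factorization
    (∀ (p : ℝ) (n k : ℕ), 1 ≤ p → 2 ≤ n → 1 ≤ k → k ≤ n →
      IsDensityValueAt (lpMarginal p n (chainDirection n k)) 0
        (centralDensity p n (chainDirection n k)) ∧
      centralDensity p n (chainDirection n k) =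
        Real.Gamma (1 + (n : ℝ) / p) / Real.Gamma (1 + ((n : ℝ) - 1) / p) *
          (Real.Gamma (1 + ((k : ℝ) - 1) / p) / (2 * Real.Gamma (1 + 1 / p)) ^ k) *
          hyperplaneSection p k ∧
      centralDensity p n (chainDirection n k) =
        Real.Gamma (1 + (n : ℝ) / p) / Real.Gamma (1 + ((n : ℝ) - 1) / p) *
          endpointConstant p k) ∧
    -- Fourier and probabilistic representations of the endpoint constants
    (∀ (p : ℝ) (k : ℕ), 1 ≤ p → 1 ≤ k →
      Integrable (fun ξ : ℝ => genGaussianCharFun p ξ ^ k) ∧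
      (endpointConstant p k : ℂ) =
        ((√(k : ℝ) / (2 * Real.pi) : ℝ) : ℂ) * ∫ ξ : ℝ, genGaussianCharFun p ξ ^ k) ∧
    (∀ (p : ℝ) (k : ℕ), 1 ≤ p → 1 ≤ k →
      ∀ (Ω : Type*) [MeasurableSpace Ω] (P : Measure Ω) [IsProbabilityMeasure P]
        (Z : Fin k → Ω → ℝ), iIndepFun Z P → (∀ i, HasLaw (Z i) (genGaussian p) P) →
        IsDensityValueAt (P.map (fun ω => (∑ i, Z i ω) / √(k : ℝ))) 0 (endpointConstant p k)) ∧
    -- strict monotonicity of the endpoint constants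
    (∀ p : ℝ, 1 ≤ p → p < 2 → ∀ k : ℕ, 1 ≤ k →
      endpointConstant p (k + 1) < endpointConstant p k) ∧
    -- strict endpoint chain
    (∀ (p : ℝ) (n : ℕ), 1 ≤ p → p < 2 → 2 ≤ n → ∀ k : ℕ, 1 ≤ k → k < n →
      centralDensity p n (chainDirection n (k + 1)) < centralDensity p n (chainDirection n k)) := by
  have hgamma : ∀ (p : ℝ) (n : ℕ), 1 ≤ p → 2 ≤ n →
      0 < Real.Gamma (1 + (n : ℝ) / p) / Real.Gamma (1 + ((n : ℝ) - 1) / p) := by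
    intro p n hp hn
    have hn' : (2 : ℝ) ≤ n := by exact_mod_cast hn
    have h1 : 0 ≤ ((n : ℝ) - 1) / p := div_nonneg (by linarith) (by linarith)
    exact div_pos (Real.Gamma_pos_of_pos (by positivity)) (Real.Gamma_pos_of_pos (by linarith))
  refine ⟨fun p n k hp hn hk hkn => ?_, fun p k hp hk =>
    ⟨integrable_genGaussianCharFun_pow hp hk, endpointConstant_eq_integral_charFun hp hk⟩,
    fun p k hp hk Ω _ P _ Z hZ hlaw => isDensityValueAt_normalized_sum hp hk hZ hlaw,
    fun p hp h2 k hk => endpointConstant_succ_lt hp h2 hk, fun p n hp h2 hn k hk hkn => ?_⟩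
  · have h := isDensityValueAt_lpMarginal_chainDirection hp hk hkn
    have hval : centralDensity p n (chainDirection n k) = _ := h.densityAt_eq
    refine ⟨by rwa [hval], ?_, hval⟩
    rw [hval, endpointConstant, mul_assoc]
  · have e1 : centralDensity p n (chainDirection n k) = _ :=
      (isDensityValueAt_lpMarginal_chainDirection hp hk hkn.le).densityAt_eq
    have e2 : centralDensity p n (chainDirection n (k + 1)) = _ :=
      (isDensityValueAt_lpMarginal_chainDirection hp (Nat.le_add_left 1 k) hkn).densityAt_eq
    rw [e1, e2]
    exact mul_lt_mul_of_pos_left (endpointConstant_succ_lt hp h2 hk) (hgamma p n hp hn)
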